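/- **Setting.** Let $\mathcal X$ be a set, $f:\mathbb R^d\times\mathcal X\to\mathbb R$ a loss that is measurable in its first argument, and $\mathcal D=(x_1,\dots,x_n)\in\mathcal X^n$ a dataset. Two datasets in $\mathcal X^n$ are adjacent if they differ in at most one record. A randomized mechanism $\mathcal A$ on $\mathcal X^n$ is $(\epsilon,\delta)$-differentially private (DP) if $\Pr[\mathcal A(\mathcal D)\in s]\le e^{\epsilon}\Pr[\mathcal A(\mathcal D')\in s]+\delta$ for all adjacent $\mathcal D,\mathcal D'$ and all measurable sets $s$ of outputs. **Algorithm (stagewise DP zeroth-order optimizer).** Inputs: a starting point $\theta^0\in\mathbb R^d$, integers $P\ge1$ (number of directions), $1\le m\le n$ (sample size), $S\ge 0$ (number of stages), $T_0\ge 0$, and reals $C>0$ (clipping threshold), $\sigma$ (noise scale), $\lambda>0$, $\eta_0\ge0$, $\beta_0>0$, $k>0$. For $s=1,\dots,S$ put $\beta_s=k\beta_{s-1}$, $T_s=2T_{s-1}$, $\eta_s=\eta_{s-1}/2$, set $\theta_0=\theta^{s-1}$, and for $t=1,\dots,T_s$ do the following with fresh independent randomness: draw a uniformly random $m$-element subset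 $\xi_t=\{x_t^1,\dots,x_t^m\}$ of the $n$ data points and $P$ independent standard Gaussian vectors $v_t^1,\dots,v_t^P\in\mathbb R^d$; for each $p$ and $i$ compute $$g^{i,p}=\frac{1}{2\beta_s}\bigl(f(\theta_{t-1}+\beta_sv_t^p,x_t^i)-f(\theta_{t-1}-\beta_sv_t^p,x_t^i)\bigr),\qquad \hat g^{i,p}=\frac{g^{i,p}}{\max\{1,|g^{i,p}|/C\}};$$ draw independent noises $z_t^p\sim N(0,\sigma^2C^2)$ and set $$\theta_t=\theta_{t-1}-\eta_s\cdot\frac1P\sum_{p=1}^P\frac1m\Bigl(\sum_{i=1}^m\bigl(\hat g^{i,p}+\tfrac1\lambda\|\theta_{t-1}-\theta_0\|\bigr)+z_t^p\Bigr)v_t^p .$$ Set $\theta^s=\theta_{T_s}$. The output is $\theta^S$. Let $T=\sum_{s=1}^ST_s$ be the total number of iterations. **Theorem.** For every $K>0$ there are constants $c_1,c_2>0$, depending only on $K$, such that for all data and parameters as above, all $\delta>0$ and all $\epsilon>0$ with $\epsilon\le K\log(P/\delta)$ and $\epsilon<c_1m^2T/n^2$, the algorithm $\mathcal D\mapsto\theta^S$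 is $(\epsilon,\delta)$-DP whenever $$\sigma^2\ \ge\ \frac{c_2^2\,P^2m^2\,T\log(P/\delta)}{\epsilon^2n^2}.$$ -/

import Mathlib

open MeasureTheory ProbabilityTheory
open scoped ENNReal NNReal

noncomputable section

namespace DPZO

/-- Two datasets of size `n` are adjacent if they differ in at most one record
(Hamming distance at most one). -/
def Adjacent {X : Type*} {n : ℕ} (D D' : Fin n → X) : Prop :=
  ∃ i, ∀ j, j ≠ i → D j = D' j

/-- `(ε, δ)`-differential privacy of a randomized mechanism `A`, given by the law `A D` of its
output on each dataset `D` of size `n`. -/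
def IsDP {X Y : Type*} [MeasurableSpace Y] {n : ℕ} (A : (Fin n → X) → Measure Y)
    (ε δ : ℝ) : Prop :=
  ∀ D D' : Fin n → X, Adjacent D D' → ∀ s : Set Y, MeasurableSet s →
    A D s ≤ ENNReal.ofReal (Real.exp ε) * A D' s + ENNReal.ofReal δ

/-- The parameter space `ℝ^d` with its Euclidean norm. -/
abbrev Param (d : ℕ) : Type := EuclideanSpace ℝ (Fin d)

/-- The inputs of the stagewise algorithm, apart from the loss, the starting point and the data. -/
structure Config where
  /-- number of random directions per iteration -/
  P : ℕ
  /-- number of data points sampled per iteration -/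
  m : ℕ
  /-- number of stages -/
  S : ℕ
  /-- initial iteration number -/
  T₀ : ℕ
  /-- clipping threshold -/
  C : ℝ
  /-- noise scale -/
  σ : ℝ
  /-- regularization parameter `λ` -/
  lam : ℝ
  /-- initial stepsize -/
  η₀ : ℝ
  /-- initial zeroth-order scale parameter -/
  β₀ : ℝ
  /-- growth factor of the zeroth-order scale parameter -/
  k : ℝ

namespace Config

variable (c : Config)

/-- `β_s = k β_{s-1}`. -/
def β : ℕ → ℝ
  | 0 => c.β₀
  | s + 1 => c.k * β s

/-- `T_s = 2 T_{s-1}`. -/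
def T : ℕ → ℕ
  | 0 => c.T₀
  | s + 1 => 2 * T s

/-- `η_s = η_{s-1} / 2`. -/
def η : ℕ → ℝ
  | 0 => c.η₀
  | s + 1 => η s / 2

/-- The total number `T_1 + ⋯ + T_S` of iterations over all stages. -/
def totalSteps : ℕ := ∑ s ∈ Finset.Icc 1 c.S, c.T s

end Config

/-- Clipping of a scalar to `[-C, C]`: `g / max {1, |g| / C}`. -/
def clip (C g : ℝ) : ℝ := g / max 1 (|g| / C)

/-- The scalar two-point finite difference
`(f(θ + βv, x) - f(θ - βv, x)) / (2β)`. -/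
def finiteDiff {X : Type*} {d : ℕ} (f : Param d → X → ℝ) (β : ℝ) (θ v : Param d) (x : X) : ℝ :=
  1 / (2 * β) * (f (θ + β • v) x - f (θ - β • v) x)

section Algorithm

variable {X : Type*} {d n : ℕ} (c : Config) (f : Param d → X → ℝ) (D : Fin n → X)

/-- One update of the inner loop in stage `s`, as a function of the reference point `θ₀` of the
stage, the current point `θ`, the index set `B` of the minibatch, the directions `v p` and the
noises `z p`. -/
def update (s : ℕ) (θ₀ θ : Param d) (B : Finset (Fin n)) (v : Fin c.P → Param d)
    (z : Fin c.P → ℝ) : Param d :=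
  θ - c.η s • ((1 / (c.P : ℝ)) • ∑ p,
    (1 / (c.m : ℝ) *
      ((∑ i ∈ B, (clip c.C (finiteDiff f (c.β s) θ (v p) (D i)) + 1 / c.lam * ‖θ - θ₀‖))
        + z p)) • v p)

/-- The law of one iteration of the inner loop: the minibatch is uniform among the `m`-element
subsets of the `n` data points, the `P` directions are standard Gaussian vectors, the `P` scalar
noises have law `N(0, σ²C²)`, and all of them are independent. -/
def stepLaw (s : ℕ) (θ₀ θ : Param d) : Measure (Param d) :=
  ((n.choose c.m : ℝ≥0∞)⁻¹) • ∑ B ∈ Finset.powersetCard c.m (Finset.univ : Finset (Fin n)),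
    ((Measure.pi fun _ : Fin c.P => stdGaussian (Param d)).prod
      (Measure.pi fun _ : Fin c.P => gaussianReal 0 (Real.toNNReal (c.σ ^ 2 * c.C ^ 2)))).map
        fun w => update c f D s θ₀ θ B w.1 w.2

/-- The law of the inner iterate after `t` iterations of stage `s`, started at `θ₀`. -/
def innerLaw (s : ℕ) (θ₀ : Param d) : ℕ → Measure (Param d)
  | 0 => Measure.dirac θ₀
  | t + 1 => (innerLaw s θ₀ t).bind (stepLaw c f D s θ₀)

/-- The law of the point returned by the first `s` stages, started at `θinit`: stage `s + 1` runs
`T_{s+1}` iterations of the inner loop from the point returned by stage `s`. -/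
def stageLaw (θinit : Param d) : ℕ → Measure (Param d)
  | 0 => Measure.dirac θinit
  | s + 1 => (stageLaw θinit s).bind fun θ₀ => innerLaw c f D (s + 1) θ₀ (c.T (s + 1))

/-- The law of the output of the stagewise private zeroth-order algorithm on the dataset `D`. -/
def stagewiseDPZO (θinit : Param d) : Measure (Param d) := stageLaw c f D θinit c.S

end Algorithm

end DPZO

end

/-!
The Rényi divergence bounds are used in their dual form `∫ g ∂μ ≤ A (∫ g ^ r ∂ν) ^ (1 / r)`, in
which composition over iterations and stages multiplies the constants, and evaluating at an
indicator and splitting the product by weighted AM-GM gives `(ε, δ)`-privacy.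

Conditionally on its random directions, an iteration is a function of a subsampled Gaussian
mechanism. Let `i₀` be the record in which the two datasets differ. A minibatch containing `i₀` is
paired with the minibatches obtained by exchanging `i₀` for another record; this writes both output
laws as averages, over the pairs, of mixtures `(1 - q) γ + q γ'` with `q = m / n`, where the
Gaussian measure `γ` does not involve the record `i₀` and `γ'` is a translate of `γ`. The laws for
the two datasets share `γ`, and are compared through it.

A translation multiplies the density `R = dγ' / dγ` by a constant. Hence the moments of the mixture
density `1 - q + q R`, of positive and negative order, satisfy recursions in the exponent, which
bound the moment of order `k` by `exp (O (k² q² M))`, where `M` is the squared length of the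
translation in units of the noise. The order `k ≈ 8 L / ε`, with `L = log (P / δ)`,
balances this against the loss `L / k` of the conversion to `(ε, δ)`-privacy.
-/

namespace DPZO

/-- Weighted AM-GM: `e^a y^θ = (e^ε y)^θ (e^((a - θ ε) / (1 - θ)))^(1 - θ)`. -/
lemma exp_mul_rpow_le {a ε δ θ y : ℝ} (hθ0 : 0 ≤ θ) (hθ1 : θ < 1) (hδ : 0 < δ)
    (hy : 0 ≤ y) (h : a - θ * ε ≤ (1 - θ) * Real.log δ) :
    Real.exp a * y ^ θ ≤ Real.exp ε * y + δ := by
  have hθ : 0 < 1 - θ := sub_pos.2 hθ1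
  have hsplit : Real.exp a * y ^ θ =
      (Real.exp ε * y) ^ θ * Real.exp ((a - θ * ε) / (1 - θ)) ^ (1 - θ) := by
    rw [Real.mul_rpow (Real.exp_pos _).le hy, ← Real.exp_mul, ← Real.exp_mul,
      div_mul_cancel₀ _ hθ.ne', mul_right_comm, ← Real.exp_add]
    ring_nf
  have hexp : Real.exp ((a - θ * ε) / (1 - θ)) ≤ δ := by
    rw [← Real.le_log_iff_exp_le hδ, div_le_iff₀ hθ]
    linarith
  calc Real.exp a * y ^ θ
      ≤ θ * (Real.exp ε * y) + (1 - θ) * Real.exp ((a - θ * ε) / (1 - θ)) := by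
        rw [hsplit]
        exact Real.geom_mean_le_arith_mean2_weighted hθ0 hθ.le (by positivity) (Real.exp_pos _).le
          (by ring)
    _ ≤ 1 * (Real.exp ε * y) + 1 * δ := by
        gcongr
        linarith
    _ = Real.exp ε * y + δ := by ring

/-- Dual form of a Rényi divergence bound: with `1 / a + 1 / r = 1`, it says that the density of
`μ` with respect to `ν` has norm at most `A` in `L^a(ν)`. -/
def DualRenyi {Y : Type*} [MeasurableSpace Y] (r : ℝ) (A : ℝ≥0∞) (μ ν : Measure Y) : Prop :=
  ∀ g : Y → ℝ≥0∞, Measurable g → ∫⁻ y, g y ∂μ ≤ A * (∫⁻ y, g y ^ r ∂ν) ^ (1 / r)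

namespace DualRenyi

variable {Y Z : Type*} [MeasurableSpace Y] [MeasurableSpace Z] {r : ℝ} {A B : ℝ≥0∞}

lemma refl (hr : 1 < r) (μ : Measure Y) [IsProbabilityMeasure μ] : DualRenyi r 1 μ μ := by
  intro g hg
  have h := ENNReal.lintegral_mul_le_Lp_mul_Lq μ (Real.HolderConjugate.conjExponent hr)
    hg.aemeasurable (aemeasurable_const (b := (1 : ℝ≥0∞)))
  simpa using h

lemma mono {μ ν : Measure Y} (h : DualRenyi r A μ ν) (hAB : A ≤ B) : DualRenyi r B μ ν :=
  fun g hg => (h g hg).trans (by gcongr)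

lemma trans {s : ℝ} (hr : 0 ≤ r) {μ ν ρ : Measure Y} (hμν : DualRenyi r A μ ν)
    (hνρ : DualRenyi s B ν ρ) : DualRenyi (r * s) (A * B ^ (1 / r)) μ ρ := by
  intro g hg
  calc ∫⁻ y, g y ∂μ ≤ A * (∫⁻ y, g y ^ r ∂ν) ^ (1 / r) := hμν g hg
    _ ≤ A * (B * (∫⁻ y, (g y ^ r) ^ s ∂ρ) ^ (1 / s)) ^ (1 / r) := by
        gcongr
        exact hνρ _ (hg.pow_const r)
    _ = A * B ^ (1 / r) * (∫⁻ y, g y ^ (r * s) ∂ρ) ^ (1 / (r * s)) := by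
        simp_rw [ENNReal.mul_rpow_of_nonneg _ _ (one_div_nonneg.2 hr), ← ENNReal.rpow_mul,
          one_div_mul_one_div, mul_comm s r, mul_assoc]

lemma bind (hr : 0 < r) {μ ν : Measure Y} {κ η : Y → Measure Z} (h : DualRenyi r A μ ν)
    (hκ : Measurable κ) (hη : Measurable η) (hκη : ∀ y, DualRenyi r B (κ y) (η y)) :
    DualRenyi r (A * B) (μ.bind κ) (ν.bind η) := by
  intro g hg
  have hF : Measurable fun y => ∫⁻ z, g z ^ r ∂η y :=
    (Measure.measurable_lintegral (hg.pow_const r)).comp hη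
  rw [Measure.lintegral_bind hκ.aemeasurable hg.aemeasurable,
    Measure.lintegral_bind hη.aemeasurable (hg.pow_const r).aemeasurable]
  calc ∫⁻ y, ∫⁻ z, g z ∂κ y ∂μ ≤ ∫⁻ y, B * (∫⁻ z, g z ^ r ∂η y) ^ (1 / r) ∂μ :=
        lintegral_mono fun y => hκη y g hg
    _ = B * ∫⁻ y, (∫⁻ z, g z ^ r ∂η y) ^ (1 / r) ∂μ := lintegral_const_mul _ (hF.pow_const _)
    _ ≤ B * (A * (∫⁻ y, ((∫⁻ z, g z ^ r ∂η y) ^ (1 / r)) ^ r ∂ν) ^ (1 / r)) := by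
        gcongr
        exact h _ (hF.pow_const _)
    _ = A * B * (∫⁻ y, ∫⁻ z, g z ^ r ∂η y ∂ν) ^ (1 / r) := by
        simp_rw [← ENNReal.rpow_mul, one_div_mul_cancel hr.ne', ENNReal.rpow_one]
        ring

lemma map {μ ν : Measure Y} (h : DualRenyi r A μ ν) {F : Y → Z} (hF : Measurable F) :
    DualRenyi r A (μ.map F) (ν.map F) := by
  intro g hg
  rw [lintegral_map hg hF, lintegral_map (hg.pow_const r) hF]
  exact h _ (hg.comp hF)

lemma sum_smul {ι : Type*} (hr : 1 ≤ r) {s : Finset ι} {w : ι → ℝ≥0∞} (hw : ∑ i ∈ s, w i = 1)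
    {μ ν : ι → Measure Y} (h : ∀ i ∈ s, DualRenyi r A (μ i) (ν i)) :
    DualRenyi r A (∑ i ∈ s, w i • μ i) (∑ i ∈ s, w i • ν i) := by
  intro g hg
  have hr0 : 0 < r := by linarith
  simp only [lintegral_finsetSum_measure, lintegral_smul_measure, smul_eq_mul]
  calc ∑ i ∈ s, w i * ∫⁻ y, g y ∂μ i
      ≤ ∑ i ∈ s, w i * (A * (∫⁻ y, g y ^ r ∂ν i) ^ (1 / r)) :=
        Finset.sum_le_sum fun i hi => mul_le_mul_right (h i hi g hg) _
    _ = A * ∑ i ∈ s, w i * (∫⁻ y, g y ^ r ∂ν i) ^ (1 / r) := by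
        rw [Finset.mul_sum]
        exact Finset.sum_congr rfl fun i _ => by ring
    _ ≤ A * (∑ i ∈ s, w i * ((∫⁻ y, g y ^ r ∂ν i) ^ (1 / r)) ^ r) ^ (1 / r) := by
        gcongr
        rw [one_div r, ENNReal.le_rpow_inv_iff hr0]
        exact ENNReal.rpow_arith_mean_le_arith_mean_rpow s w _ hw hr
    _ = A * (∑ i ∈ s, w i * ∫⁻ y, g y ^ r ∂ν i) ^ (1 / r) := by
        simp_rw [← ENNReal.rpow_mul, one_div_mul_cancel hr0.ne', ENNReal.rpow_one]

section Density

variable {γ : Measure Y} {u : Y → ℝ≥0∞} {a : ℝ}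

lemma withDensity_left (hu : Measurable u) (har : a.HolderConjugate r) :
    DualRenyi r ((∫⁻ y, u y ^ a ∂γ) ^ (1 / a)) (γ.withDensity u) γ := by
  intro g hg
  rw [lintegral_withDensity_eq_lintegral_mul _ hu hg]
  exact ENNReal.lintegral_mul_le_Lp_mul_Lq γ har hu.aemeasurable hg.aemeasurable

lemma withDensity_right (hu : Measurable u) (hu0 : ∀ y, u y ≠ 0) (hut : ∀ y, u y ≠ ∞)
    (har : a.HolderConjugate r) :
    DualRenyi r ((∫⁻ y, u y ^ (1 - a) ∂γ) ^ (1 / a)) γ (γ.withDensity u) := by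
  intro g hg
  have hr0 : r ≠ 0 := har.symm.ne_zero
  have hexp : -r⁻¹ * a = 1 - a := by
    rw [← har.one_sub_inv]
    field_simp [har.ne_zero]
    ring
  have hfactor (y : Y) : g y = u y ^ (-r⁻¹) * (g y * u y ^ r⁻¹) := by
    rw [mul_left_comm, ← ENNReal.rpow_add _ _ (hu0 y) (hut y), neg_add_cancel,
      ENNReal.rpow_zero, mul_one]
  rw [lintegral_withDensity_eq_lintegral_mul _ hu (hg.pow_const r)]
  calc ∫⁻ y, g y ∂γ = ∫⁻ y, u y ^ (-r⁻¹) * (g y * u y ^ r⁻¹) ∂γ :=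
        lintegral_congr hfactor
    _ ≤ (∫⁻ y, (u y ^ (-r⁻¹)) ^ a ∂γ) ^ (1 / a) *
          (∫⁻ y, (g y * u y ^ r⁻¹) ^ r ∂γ) ^ (1 / r) :=
        ENNReal.lintegral_mul_le_Lp_mul_Lq γ har (by fun_prop) (by fun_prop)
    _ = (∫⁻ y, u y ^ (1 - a) ∂γ) ^ (1 / a) *
          (∫⁻ y, (u * fun y => g y ^ r) y ∂γ) ^ (1 / r) := by
        simp_rw [ENNReal.mul_rpow_of_nonneg _ _ har.symm.nonneg, ← ENNReal.rpow_mul, hexp,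
          inv_mul_cancel₀ hr0, ENNReal.rpow_one, Pi.mul_apply, mul_comm (u _)]

end Density

lemma measure_le {μ ν : Measure Y} [IsFiniteMeasure ν] {a ε δ : ℝ} (hr : 1 < r)
    (h : DualRenyi r (ENNReal.ofReal (Real.exp a)) μ ν) (hδ : 0 < δ)
    (hle : a - 1 / r * ε ≤ (1 - 1 / r) * Real.log δ) {s : Set Y} (hs : MeasurableSet s) :
    μ s ≤ ENNReal.ofReal (Real.exp ε) * ν s + ENNReal.ofReal δ := by
  have hr0 : 0 < r := one_pos.trans hr
  have hμν : μ s ≤ ENNReal.ofReal (Real.exp a) * ν s ^ (1 / r) := by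
    have hpow (y : Y) : s.indicator (1 : Y → ℝ≥0∞) y ^ r = s.indicator 1 y := by
      by_cases hy : y ∈ s <;> simp [hy, hr0]
    simpa only [hpow, lintegral_indicator_one hs] using
      h (s.indicator 1) (measurable_one.indicator hs)
  refine hμν.trans ?_
  rw [← ofReal_measureReal (μ := ν) (s := s), ENNReal.ofReal_rpow_of_nonneg measureReal_nonneg
    (one_div_nonneg.2 hr0.le), ← ENNReal.ofReal_mul (Real.exp_pos _).le,
    ← ENNReal.ofReal_mul (Real.exp_pos _).le, ← ENNReal.ofReal_add (by positivity) hδ.le]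
  exact ENNReal.ofReal_le_ofReal (exp_mul_rpow_le (one_div_nonneg.2 hr0.le)
    ((div_lt_one hr0).2 hr) hδ measureReal_nonneg hle)

end DualRenyi

lemma exp_sub_one_le_two_mul {x : ℝ} (hx0 : 0 ≤ x) (hx1 : x ≤ 1) : Real.exp x - 1 ≤ 2 * x := by
  have h := Real.abs_exp_sub_one_le (x := x) (by rwa [abs_of_nonneg hx0])
  rw [abs_of_nonneg hx0] at h
  exact (le_abs_self _).trans h

lemma mix_exp_le_exp_two_mul {q x : ℝ} (hq : 0 ≤ q) (hx0 : 0 ≤ x) (hx1 : x ≤ 1) :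
    1 - q + q * Real.exp x ≤ Real.exp (2 * q * x) := by
  have h := mul_le_mul_of_nonneg_left (exp_sub_one_le_two_mul hx0 hx1) hq
  linarith [Real.add_one_le_exp (2 * q * x)]

/-- Bernoulli's inequality for `u / w`. -/
lemma inv_pow_succ_le {u w : ℝ} (hu : 0 < u) (huw : u ≤ w) (k : ℕ) :
    u⁻¹ ^ (k + 1) ≤ w⁻¹ ^ (k + 1) + (k + 1) * (w - u) * u⁻¹ ^ (k + 2) := by
  have hw : 0 < w := hu.trans_le huw
  have hratio : 1 - (w - u) / u ≤ u / w := by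
    rw [← sub_nonneg]
    have : u / w - (1 - (w - u) / u) = (w - u) ^ 2 / (u * w) := by
      field_simp
      ring
    rw [this]
    positivity
  have hbernoulli : 1 + (k + 1) * (u / w - 1) ≤ (u / w) ^ (k + 1) := by
    have := one_add_mul_le_pow (a := u / w - 1) (by linarith [div_pos hu hw]) (k + 1)
    rwa [add_sub_cancel, Nat.cast_add_one] at this
  have hratio' : 1 - (k + 1) * ((w - u) / u) ≤ (u / w) ^ (k + 1) := by
    have := mul_le_mul_of_nonneg_left hratio (Nat.cast_add_one_pos (α := ℝ) k).le
    linarith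
  calc u⁻¹ ^ (k + 1)
      = (1 - (k + 1) * ((w - u) / u)) * u⁻¹ ^ (k + 1)
          + (k + 1) * (w - u) * u⁻¹ ^ (k + 2) := by ring
    _ ≤ (u / w) ^ (k + 1) * u⁻¹ ^ (k + 1) + (k + 1) * (w - u) * u⁻¹ ^ (k + 2) := by gcongr
    _ = w⁻¹ ^ (k + 1) + (k + 1) * (w - u) * u⁻¹ ^ (k + 2) := by
        rw [← mul_pow]
        field_simp

lemma le_ofReal_exp_mul_of_le_add {x : ℝ≥0∞} {E t : ℝ} (hx : x ≠ ∞) (hE : 0 ≤ E) (ht0 : 0 ≤ t)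
    (ht : t ≤ 1 / 2) (h : x ≤ ENNReal.ofReal E + ENNReal.ofReal t * x) :
    x ≤ ENNReal.ofReal (Real.exp (2 * t) * E) := by
  lift x to ℝ≥0 using hx
  rw [← ENNReal.ofReal_coe_nnreal, ← ENNReal.ofReal_mul ht0,
    ← ENNReal.ofReal_add hE (by positivity), ENNReal.ofReal_le_ofReal_iff (by positivity)] at h
  rw [← ENNReal.ofReal_coe_nnreal]
  refine ENNReal.ofReal_le_ofReal ?_
  have hexp : 1 ≤ Real.exp (2 * t) * (1 - t) := by
    nlinarith [Real.add_one_le_exp (2 * t)]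
  calc (x : ℝ) ≤ Real.exp (2 * t) * (1 - t) * x := le_mul_of_one_le_left x.coe_nonneg hexp
    _ = Real.exp (2 * t) * (x - t * x) := by ring
    _ ≤ Real.exp (2 * t) * E := by
        gcongr
        linarith

lemma ofReal_one_sub_add_ofReal {q : ℝ} (hq0 : 0 ≤ q) (hq1 : q ≤ 1) :
    ENNReal.ofReal (1 - q) + ENNReal.ofReal q = 1 := by
  rw [← ENNReal.ofReal_add (sub_nonneg.2 hq1) hq0, sub_add_cancel, ENNReal.ofReal_one]

/-- A map `τ` that acts on `γ` as a translation acts on a Gaussian measure: `R` is the density of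
`γ.map τ` with respect to `γ`, and moving along `τ` multiplies `R` by `exp κ`. -/
structure CameronMartinShift {Ω : Type*} [MeasurableSpace Ω] (γ : Measure Ω) (τ : Ω → Ω)
    (R : Ω → ℝ) (κ : ℝ) : Prop where
  measurable_shift : Measurable τ
  measurable_density : Measurable R
  density_pos : ∀ ω, 0 < R ω
  withDensity_density : γ.withDensity (fun ω => ENNReal.ofReal (R ω)) = γ.map τ
  density_shift : ∀ ω, R (τ ω) = Real.exp κ * R ω

/-- The density of the mixture `(1 - q) • γ + q • γ.map τ` when `γ.map τ` has density `R`. -/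
noncomputable def mixDensity {Ω : Type*} (q : ℝ) (R : Ω → ℝ) (ω : Ω) : ℝ := 1 - q + q * R ω

section MixDensity

variable {Ω : Type*} {q : ℝ} {R : Ω → ℝ}

lemma mixDensity_pos (hq0 : 0 ≤ q) (hq1 : q ≤ 1) {ω : Ω} (hR : 0 < R ω) :
    0 < mixDensity q R ω := by
  rcases hq1.lt_or_eq with hq | rfl
  · exact add_pos_of_pos_of_nonneg (sub_pos.2 hq) (by positivity)
  · simpa [mixDensity] using hR

lemma measurable_mixDensity [MeasurableSpace Ω] (hR : Measurable R) :
    Measurable (mixDensity q R) :=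
  (hR.const_mul q).const_add (1 - q)

end MixDensity

namespace CameronMartinShift

variable {Ω : Type*} [MeasurableSpace Ω] {γ : Measure Ω} {τ : Ω → Ω} {R : Ω → ℝ} {κ q : ℝ}

lemma lintegral_mul_affine (h : CameronMartinShift γ τ R κ) {a b : ℝ} (ha : 0 ≤ a) (hb : 0 ≤ b)
    {F : Ω → ℝ≥0∞} (hF : Measurable F) :
    ∫⁻ ω, F ω * ENNReal.ofReal (a + b * R ω) ∂γ =
      ENNReal.ofReal a * ∫⁻ ω, F ω ∂γ + ENNReal.ofReal b * ∫⁻ ω, F (τ ω) ∂γ := by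
  have hR : Measurable fun ω => ENNReal.ofReal (R ω) := h.measurable_density.ennreal_ofReal
  have hshift : ∫⁻ ω, F (τ ω) ∂γ = ∫⁻ ω, ENNReal.ofReal (R ω) * F ω ∂γ := by
    rw [← lintegral_map hF h.measurable_shift, ← h.withDensity_density,
      lintegral_withDensity_eq_lintegral_mul _ hR hF]
    rfl
  have hRF : Measurable fun ω => ENNReal.ofReal (R ω) * F ω := hR.mul hF
  rw [hshift, ← lintegral_const_mul _ hF, ← lintegral_const_mul _ hRF,
    ← lintegral_add_left (hF.const_mul _)]
  refine lintegral_congr fun ω => ?_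
  rw [ENNReal.ofReal_add ha (mul_nonneg hb (h.density_pos ω).le), ENNReal.ofReal_mul hb]
  ring

lemma smul_add_smul_map_eq_withDensity (h : CameronMartinShift γ τ R κ) (hq0 : 0 ≤ q)
    (hq1 : q ≤ 1) :
    ENNReal.ofReal (1 - q) • γ + ENNReal.ofReal q • γ.map τ =
      γ.withDensity fun ω => ENNReal.ofReal (mixDensity q R ω) := by
  refine Measure.ext_of_lintegral _ fun F hF => ?_
  rw [lintegral_add_measure, lintegral_smul_measure, lintegral_smul_measure,
    lintegral_map hF h.measurable_shift, smul_eq_mul, smul_eq_mul,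
    ← h.lintegral_mul_affine (sub_nonneg.2 hq1) hq0 hF,
    lintegral_withDensity_eq_lintegral_mul _
      (measurable_mixDensity h.measurable_density).ennreal_ofReal hF]
  exact lintegral_congr fun ω => mul_comm _ _

lemma lintegral_mixDensity_tilt_pow_succ (h : CameronMartinShift γ τ R κ) (hq0 : 0 ≤ q)
    (hq1 : q ≤ 1) (n : ℕ) (l : ℝ) :
    ∫⁻ ω, ENNReal.ofReal (mixDensity q (Real.exp l • R) ω ^ (n + 1)) ∂γ =
      ENNReal.ofReal (1 - q) *
          ∫⁻ ω, ENNReal.ofReal (mixDensity q (Real.exp l • R) ω ^ n) ∂γ +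
        ENNReal.ofReal (q * Real.exp l) *
          ∫⁻ ω, ENNReal.ofReal (mixDensity q (Real.exp (l + κ) • R) ω ^ n) ∂γ := by
  have hpos (ω : Ω) : 0 < mixDensity q (Real.exp l • R) ω :=
    mixDensity_pos hq0 hq1 (mul_pos (Real.exp_pos l) (h.density_pos ω))
  have hmeas : Measurable fun ω => ENNReal.ofReal (mixDensity q (Real.exp l • R) ω ^ n) :=
    ((measurable_mixDensity (h.measurable_density.const_smul _)).pow_const n).ennreal_ofReal
  have hshift (ω : Ω) : mixDensity q (Real.exp (l + κ) • R) ω =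
      mixDensity q (Real.exp l • R) (τ ω) := by
    simp only [mixDensity, Pi.smul_apply, smul_eq_mul, h.density_shift, Real.exp_add, mul_assoc]
  simp only [hshift]
  rw [← h.lintegral_mul_affine (sub_nonneg.2 hq1) (by positivity) hmeas]
  refine lintegral_congr fun ω => ?_
  rw [← ENNReal.ofReal_mul (pow_nonneg (hpos ω).le n), pow_succ, mul_assoc q]
  rfl

lemma lintegral_mixDensity_tilt_pow_le (h : CameronMartinShift γ τ R κ)
    [IsProbabilityMeasure γ] (hκ : 0 ≤ κ) (hq0 : 0 ≤ q) (hq1 : q ≤ 1) (n : ℕ) {l : ℝ}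
    (hl : 0 ≤ l) (hln : l + 2 * n * κ ≤ 1) :
    ∫⁻ ω, ENNReal.ofReal (mixDensity q (Real.exp l • R) ω ^ n) ∂γ ≤
      ENNReal.ofReal (Real.exp (2 * n * q * l + 2 * n ^ 2 * q ^ 2 * κ)) := by
  induction n generalizing l with
  | zero => simp
  | succ n ih =>
    push_cast at hln
    set E := Real.exp (2 * n * q * l + 2 * n ^ 2 * q ^ 2 * κ) with hE
    have hqκ : l + 2 * n * (q * κ) ≤ 1 := by
      have : 2 * n * (q * κ) ≤ 2 * n * κ := by
        gcongr
        exact mul_le_of_le_one_left hκ hq1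
      linarith
    have hexp : Real.exp l * Real.exp (2 * n * q * (l + κ) + 2 * n ^ 2 * q ^ 2 * κ) =
        E * Real.exp (l + 2 * n * (q * κ)) := by
      rw [hE, ← Real.exp_add, ← Real.exp_add]
      ring_nf
    rw [h.lintegral_mixDensity_tilt_pow_succ hq0 hq1]
    calc _ ≤ ENNReal.ofReal (1 - q) * ENNReal.ofReal E + ENNReal.ofReal (q * Real.exp l) *
            ENNReal.ofReal (Real.exp (2 * n * q * (l + κ) + 2 * n ^ 2 * q ^ 2 * κ)) := by
          gcongr
          · exact ih hl (by linarith)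
          · exact ih (by positivity) (by linarith)
      _ = ENNReal.ofReal (E * (1 - q + q * Real.exp (l + 2 * n * (q * κ)))) := by
          have := sub_nonneg.2 hq1
          rw [← ENNReal.ofReal_mul this, ← ENNReal.ofReal_mul (by positivity),
            ← ENNReal.ofReal_add (by positivity) (by positivity), mul_assoc q, hexp]
          ring_nf
      _ ≤ ENNReal.ofReal (E * Real.exp (2 * q * (l + 2 * n * (q * κ)))) := by
          gcongr
          exact mix_exp_le_exp_two_mul hq0 (by positivity) hqκ
      _ ≤ _ := by
          rw [hE, ← Real.exp_add]
          refine ENNReal.ofReal_le_ofReal (Real.exp_le_exp.2 ?_)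
          push_cast
          linarith [mul_nonneg (sq_nonneg q) hκ]

lemma lintegral_mixDensity_pow_le (h : CameronMartinShift γ τ R κ) [IsProbabilityMeasure γ]
    (hκ : 0 ≤ κ) (hq0 : 0 ≤ q) (hq1 : q ≤ 1) {n : ℕ} (hn : 2 * n * κ ≤ 1) :
    ∫⁻ ω, ENNReal.ofReal (mixDensity q R ω ^ n) ∂γ ≤
      ENNReal.ofReal (Real.exp (2 * n ^ 2 * q ^ 2 * κ)) := by
  simpa using h.lintegral_mixDensity_tilt_pow_le hκ hq0 hq1 n le_rfl (by simpa using hn)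

lemma mixDensity_shift (h : CameronMartinShift γ τ R κ) (ω : Ω) :
    mixDensity q R (τ ω) = mixDensity q R ω + q * (Real.exp κ - 1) * R ω := by
  rw [mixDensity, mixDensity, h.density_shift]
  ring

lemma mixDensity_le_shift (h : CameronMartinShift γ τ R κ) (hκ : 0 ≤ κ) (hq0 : 0 ≤ q) (ω : Ω) :
    mixDensity q R ω ≤ mixDensity q R (τ ω) := by
  rw [h.mixDensity_shift]
  have := mul_nonneg (mul_nonneg hq0 (sub_nonneg.2 (Real.one_le_exp hκ))) (h.density_pos ω).le
  linarith

lemma mixDensity_shift_le (h : CameronMartinShift γ τ R κ) (hκ : 0 ≤ κ) (hq1 : q ≤ 1) (ω : Ω) :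
    mixDensity q R (τ ω) ≤ Real.exp κ * mixDensity q R ω := by
  rw [mixDensity, mixDensity, h.density_shift]
  have := mul_nonneg (sub_nonneg.2 hq1) (sub_nonneg.2 (Real.one_le_exp hκ))
  linarith

lemma measurable_inv_mixDensity_pow (h : CameronMartinShift γ τ R κ) (k : ℕ) :
    Measurable fun ω => ENNReal.ofReal ((mixDensity q R ω)⁻¹ ^ k) :=
  ((measurable_mixDensity h.measurable_density).inv.pow_const k).ennreal_ofReal

lemma measurable_inv_mixDensity_shift_pow (h : CameronMartinShift γ τ R κ) (k : ℕ) :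
    Measurable fun ω => ENNReal.ofReal ((mixDensity q R (τ ω))⁻¹ ^ k) :=
  (h.measurable_inv_mixDensity_pow k).comp h.measurable_shift

section NegativeMoments

variable (h : CameronMartinShift γ τ R κ) (hκ : 0 ≤ κ) (hq0 : 0 ≤ q) (hq1 : q ≤ 1)
include h hq0 hq1

lemma lintegral_inv_mixDensity_pow_eq (k : ℕ) :
    ∫⁻ ω, ENNReal.ofReal ((mixDensity q R ω)⁻¹ ^ k) ∂γ =
      ENNReal.ofReal (1 - q) * ∫⁻ ω, ENNReal.ofReal ((mixDensity q R ω)⁻¹ ^ (k + 1)) ∂γ +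
        ENNReal.ofReal q * ∫⁻ ω, ENNReal.ofReal ((mixDensity q R (τ ω))⁻¹ ^ (k + 1)) ∂γ := by
  rw [← h.lintegral_mul_affine (sub_nonneg.2 hq1) hq0 (h.measurable_inv_mixDensity_pow (k + 1))]
  refine lintegral_congr fun ω => ?_
  have hpos := mixDensity_pos hq0 hq1 (h.density_pos ω)
  rw [← ENNReal.ofReal_mul (by positivity), pow_succ, mul_assoc]
  change _ = ENNReal.ofReal (_ * (_ * mixDensity q R ω))
  rw [inv_mul_cancel₀ hpos.ne', mul_one]

include hκ

lemma lintegral_inv_mixDensity_shift_pow_le (k : ℕ) :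
    ∫⁻ ω, ENNReal.ofReal ((mixDensity q R (τ ω))⁻¹ ^ (k + 1)) ∂γ ≤
      ∫⁻ ω, ENNReal.ofReal ((mixDensity q R ω)⁻¹ ^ k) ∂γ := by
  calc ∫⁻ ω, ENNReal.ofReal ((mixDensity q R (τ ω))⁻¹ ^ (k + 1)) ∂γ
      = ENNReal.ofReal (1 - q) * ∫⁻ ω, ENNReal.ofReal ((mixDensity q R (τ ω))⁻¹ ^ (k + 1)) ∂γ +
          ENNReal.ofReal q * ∫⁻ ω, ENNReal.ofReal ((mixDensity q R (τ ω))⁻¹ ^ (k + 1)) ∂γ := by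
        rw [← add_mul, ofReal_one_sub_add_ofReal hq0 hq1, one_mul]
    _ ≤ ENNReal.ofReal (1 - q) * ∫⁻ ω, ENNReal.ofReal ((mixDensity q R ω)⁻¹ ^ (k + 1)) ∂γ +
          ENNReal.ofReal q * ∫⁻ ω, ENNReal.ofReal ((mixDensity q R (τ ω))⁻¹ ^ (k + 1)) ∂γ := by
        gcongr with ω
        · exact (inv_pos.2 (mixDensity_pos hq0 hq1 (h.density_pos _))).le
        · exact mixDensity_pos hq0 hq1 (h.density_pos ω)
        · exact h.mixDensity_le_shift hκ hq0 ω
    _ = ∫⁻ ω, ENNReal.ofReal ((mixDensity q R ω)⁻¹ ^ k) ∂γ :=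
        (h.lintegral_inv_mixDensity_pow_eq hq0 hq1 k).symm

lemma lintegral_inv_mixDensity_pow_lt_top [IsFiniteMeasure γ] (k : ℕ) :
    ∫⁻ ω, ENNReal.ofReal ((mixDensity q R ω)⁻¹ ^ k) ∂γ < ∞ := by
  induction k with
  | zero => simp
  | succ k ih =>
    calc ∫⁻ ω, ENNReal.ofReal ((mixDensity q R ω)⁻¹ ^ (k + 1)) ∂γ
        ≤ ∫⁻ ω, ENNReal.ofReal (Real.exp κ ^ (k + 1)) *
            ENNReal.ofReal ((mixDensity q R (τ ω))⁻¹ ^ (k + 1)) ∂γ := by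
          refine lintegral_mono fun ω => ?_
          have hpos := mixDensity_pos hq0 hq1 (h.density_pos ω)
          have hpos' := mixDensity_pos hq0 hq1 (h.density_pos (τ ω))
          rw [← ENNReal.ofReal_mul (by positivity), ← mul_pow]
          gcongr
          rw [← div_eq_mul_inv, inv_le_iff_one_le_mul₀ hpos, div_mul_eq_mul_div, one_le_div hpos']
          exact h.mixDensity_shift_le hκ hq1 ω
      _ ≤ ENNReal.ofReal (Real.exp κ ^ (k + 1)) *
            ∫⁻ ω, ENNReal.ofReal ((mixDensity q R ω)⁻¹ ^ k) ∂γ := by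
          rw [lintegral_const_mul _
            (h.measurable_inv_mixDensity_shift_pow (k + 1))]
          exact mul_le_mul_right (h.lintegral_inv_mixDensity_shift_pow_le hκ hq0 hq1 k) _
      _ < ∞ := ENNReal.mul_lt_top ENNReal.ofReal_lt_top ih

/-- Bernoulli's inequality at each point, followed by a second shift to absorb the factor `R` of
the error term. -/
lemma lintegral_inv_mixDensity_pow_succ_le_shift (k : ℕ) :
    ∫⁻ ω, ENNReal.ofReal ((mixDensity q R ω)⁻¹ ^ (k + 1)) ∂γ ≤
      ∫⁻ ω, ENNReal.ofReal ((mixDensity q R (τ ω))⁻¹ ^ (k + 1)) ∂γ +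
        ENNReal.ofReal ((k + 1) * q * (Real.exp κ - 1)) *
          ∫⁻ ω, ENNReal.ofReal ((mixDensity q R ω)⁻¹ ^ (k + 1)) ∂γ := by
  have hexp : 0 ≤ Real.exp κ - 1 := sub_nonneg.2 (Real.one_le_exp hκ)
  have hcoef : 0 ≤ (k + 1) * q * (Real.exp κ - 1) := by positivity
  have hpoint (ω : Ω) : ENNReal.ofReal ((mixDensity q R ω)⁻¹ ^ (k + 1)) ≤
      ENNReal.ofReal ((mixDensity q R (τ ω))⁻¹ ^ (k + 1)) +
        ENNReal.ofReal ((mixDensity q R ω)⁻¹ ^ (k + 2)) *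
          ENNReal.ofReal (0 + (k + 1) * q * (Real.exp κ - 1) * R ω) := by
    have hpos := mixDensity_pos hq0 hq1 (h.density_pos ω)
    have hpos' := mixDensity_pos hq0 hq1 (h.density_pos (τ ω))
    have hR := h.density_pos ω
    rw [← ENNReal.ofReal_mul (by positivity), ← ENNReal.ofReal_add (by positivity) (by positivity)]
    refine ENNReal.ofReal_le_ofReal
      ((inv_pow_succ_le hpos (h.mixDensity_le_shift hκ hq0 ω) k).trans_eq ?_)
    rw [h.mixDensity_shift ω]
    ring
  refine (lintegral_mono hpoint).trans ?_
  rw [lintegral_add_left (h.measurable_inv_mixDensity_shift_pow (k + 1)),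
    h.lintegral_mul_affine le_rfl hcoef (h.measurable_inv_mixDensity_pow (k + 2)),
    ENNReal.ofReal_zero, zero_mul, zero_add]
  gcongr _ + _ * ?_
  exact h.lintegral_inv_mixDensity_shift_pow_le hκ hq0 hq1 (k + 1)

lemma lintegral_inv_mixDensity_pow_succ_le (k : ℕ) :
    ∫⁻ ω, ENNReal.ofReal ((mixDensity q R ω)⁻¹ ^ (k + 1)) ∂γ ≤
      ∫⁻ ω, ENNReal.ofReal ((mixDensity q R ω)⁻¹ ^ k) ∂γ +
        ENNReal.ofReal ((k + 1) * q ^ 2 * (Real.exp κ - 1)) *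
          ∫⁻ ω, ENNReal.ofReal ((mixDensity q R ω)⁻¹ ^ (k + 1)) ∂γ := by
  have hstep := h.lintegral_inv_mixDensity_pow_succ_le_shift hκ hq0 hq1 k
  have hcoef : ENNReal.ofReal ((k + 1) * q ^ 2 * (Real.exp κ - 1)) =
      ENNReal.ofReal q * ENNReal.ofReal ((k + 1) * q * (Real.exp κ - 1)) := by
    rw [← ENNReal.ofReal_mul hq0]
    ring_nf
  rw [h.lintegral_inv_mixDensity_pow_eq hq0 hq1 k, hcoef, add_assoc, mul_assoc, ← mul_add]
  set I := ∫⁻ ω, ENNReal.ofReal ((mixDensity q R ω)⁻¹ ^ (k + 1)) ∂γ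
  calc I = ENNReal.ofReal (1 - q) * I + ENNReal.ofReal q * I := by
        rw [← add_mul, ofReal_one_sub_add_ofReal hq0 hq1, one_mul]
    _ ≤ _ := by gcongr

lemma lintegral_inv_mixDensity_pow_le [IsProbabilityMeasure γ] {k : ℕ} (hk : 4 * k * κ ≤ 1)
    (hκ1 : κ ≤ 1) :
    ∫⁻ ω, ENNReal.ofReal ((mixDensity q R ω)⁻¹ ^ k) ∂γ ≤
      ENNReal.ofReal (Real.exp (2 * k * (k + 1) * q ^ 2 * κ)) := by
  induction k with
  | zero => simp
  | succ k ih =>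
    push_cast at hk ⊢
    have ht : (k + 1) * q ^ 2 * (Real.exp κ - 1) ≤ 2 * (k + 1) * q ^ 2 * κ := by
      have := mul_le_mul_of_nonneg_left (exp_sub_one_le_two_mul hκ hκ1)
        (by positivity : 0 ≤ (k + 1) * q ^ 2)
      linarith
    have ht_half : 2 * (k + 1) * q ^ 2 * κ ≤ 1 / 2 := by
      have : (k + 1) * κ * q ^ 2 ≤ (k + 1) * κ := mul_le_of_le_one_right (by positivity)
        (pow_le_one₀ hq0 hq1)
      linarith
    refine (le_ofReal_exp_mul_of_le_add
      (h.lintegral_inv_mixDensity_pow_lt_top hκ hq0 hq1 (k + 1)).ne (Real.exp_pos _).le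
      (by positivity) ht_half
      ((h.lintegral_inv_mixDensity_pow_succ_le hκ hq0 hq1 k).trans
        (add_le_add (ih (by linarith)) (by gcongr)))).trans_eq ?_
    rw [← Real.exp_add]
    ring_nf

end NegativeMoments

end CameronMartinShift

lemma rpow_one_div_le_ofReal_exp {x : ℝ≥0∞} {a b p : ℝ} (hp : 0 < p)
    (hx : x ≤ ENNReal.ofReal (Real.exp a)) (hab : a ≤ p * b) :
    x ^ (1 / p) ≤ ENNReal.ofReal (Real.exp b) := by
  rw [one_div, ENNReal.rpow_inv_le_iff hp, ENNReal.ofReal_rpow_of_pos (Real.exp_pos _),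
    ← Real.exp_mul]
  refine hx.trans (ENNReal.ofReal_le_ofReal (Real.exp_le_exp.2 ?_))
  linarith

namespace CameronMartinShift

variable {Ω : Type*} [MeasurableSpace Ω] {γ : Measure Ω} [IsProbabilityMeasure γ] {τ : Ω → Ω}
  {R : Ω → ℝ} {κ q r : ℝ} {k : ℕ}

lemma dualRenyi_mixture_left (h : CameronMartinShift γ τ R κ) (hκ : 0 ≤ κ) (hq0 : 0 ≤ q)
    (hq1 : q ≤ 1) (hkr : (k : ℝ).HolderConjugate r) (hk : 4 * k * κ ≤ 1) :
    DualRenyi r (ENNReal.ofReal (Real.exp (2 * k * q ^ 2 * κ)))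
      (ENNReal.ofReal (1 - q) • γ + ENNReal.ofReal q • γ.map τ) γ := by
  have hpow (ω : Ω) : ENNReal.ofReal (mixDensity q R ω) ^ (k : ℝ) =
      ENNReal.ofReal (mixDensity q R ω ^ k) := by
    rw [ENNReal.rpow_natCast,
      ENNReal.ofReal_pow (mixDensity_pos hq0 hq1 (h.density_pos ω)).le]
  rw [h.smul_add_smul_map_eq_withDensity hq0 hq1]
  refine (DualRenyi.withDensity_left
    (measurable_mixDensity h.measurable_density).ennreal_ofReal hkr).mono ?_
  simp only [hpow]
  have : 0 ≤ k * κ := by positivity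
  exact rpow_one_div_le_ofReal_exp hkr.pos
    (h.lintegral_mixDensity_pow_le hκ hq0 hq1 (n := k) (by linarith)) (by linarith)

lemma dualRenyi_mixture_right (h : CameronMartinShift γ τ R κ) (hκ : 0 ≤ κ) (hq0 : 0 ≤ q)
    (hq1 : q ≤ 1) (hkr : (k : ℝ).HolderConjugate r) (hk : 4 * k * κ ≤ 1) :
    DualRenyi r (ENNReal.ofReal (Real.exp (2 * k * q ^ 2 * κ)))
      γ (ENNReal.ofReal (1 - q) • γ + ENNReal.ofReal q • γ.map τ) := by
  obtain ⟨b, rfl⟩ : ∃ b, k = b + 1 :=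
    Nat.exists_eq_succ_of_ne_zero (Nat.cast_ne_zero.1 hkr.ne_zero)
  have hpos (ω : Ω) : 0 < mixDensity q R ω := mixDensity_pos hq0 hq1 (h.density_pos ω)
  have hpow (ω : Ω) : ENNReal.ofReal (mixDensity q R ω) ^ (1 - ((b + 1 : ℕ) : ℝ)) =
      ENNReal.ofReal ((mixDensity q R ω)⁻¹ ^ b) := by
    rw [Nat.cast_add_one, sub_add_cancel_right, ENNReal.rpow_neg, ENNReal.rpow_natCast,
      ENNReal.inv_pow, ← ENNReal.ofReal_inv_of_pos (hpos ω),
      ENNReal.ofReal_pow (inv_pos.2 (hpos ω)).le]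
  rw [h.smul_add_smul_map_eq_withDensity hq0 hq1]
  refine (DualRenyi.withDensity_right
    (measurable_mixDensity h.measurable_density).ennreal_ofReal
    (fun ω => (ENNReal.ofReal_pos.2 (hpos ω)).ne') (fun ω => ENNReal.ofReal_ne_top) hkr).mono ?_
  simp only [hpow]
  push_cast at hk ⊢
  have : 0 ≤ b * κ := by positivity
  have : 0 ≤ (b + 1) * q ^ 2 * κ := by positivity
  exact rpow_one_div_le_ofReal_exp (by positivity)
    (h.lintegral_inv_mixDensity_pow_le hκ hq0 hq1 (k := b) (by linarith) (by linarith))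
    (by linarith)

/-- Two mixtures with the common component `γ` are compared through `γ`. -/
lemma dualRenyi_mixture {τ' : Ω → Ω} {R' : Ω → ℝ} {κ' M : ℝ} (h : CameronMartinShift γ τ R κ)
    (h' : CameronMartinShift γ τ' R' κ') (hκ : 0 ≤ κ) (hκ' : 0 ≤ κ') (hκM : κ ≤ M)
    (hκM' : κ' ≤ M) (hq0 : 0 ≤ q) (hq1 : q ≤ 1) (hkr : (k : ℝ).HolderConjugate r)
    (hk : 4 * k * M ≤ 1) :
    DualRenyi (r * r) (ENNReal.ofReal (Real.exp (4 * k * q ^ 2 * M)))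
      (ENNReal.ofReal (1 - q) • γ + ENNReal.ofReal q • γ.map τ)
      (ENNReal.ofReal (1 - q) • γ + ENNReal.ofReal q • γ.map τ') := by
  have hle {x : ℝ} (hx : x ≤ M) : 4 * k * x ≤ 1 := hk.trans' (by gcongr)
  refine ((h.dualRenyi_mixture_left hκ hq0 hq1 hkr (hle hκM)).trans hkr.symm.nonneg
    (h'.dualRenyi_mixture_right hκ' hq0 hq1 hkr (hle hκM'))).mono ?_
  have hpow : ENNReal.ofReal (Real.exp (2 * k * q ^ 2 * κ')) ^ (1 / r) ≤
      ENNReal.ofReal (Real.exp (2 * k * q ^ 2 * κ')) :=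
    (ENNReal.rpow_le_rpow_of_exponent_le
      (ENNReal.one_le_ofReal.2 (Real.one_le_exp (by positivity)))
      (by simpa using inv_le_one_of_one_le₀ hkr.symm.lt.le)).trans_eq (ENNReal.rpow_one _)
  refine (mul_le_mul_right hpow _).trans ?_
  rw [← ENNReal.ofReal_mul (Real.exp_pos _).le, ← Real.exp_add]
  refine ENNReal.ofReal_le_ofReal (Real.exp_le_exp.2 ?_)
  have hsum : 2 * k * q ^ 2 * (κ + κ') ≤ 2 * k * q ^ 2 * (M + M) := by gcongr
  linarith

end CameronMartinShift

namespace CameronMartinShift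

lemma integrable_density {Ω : Type*} [MeasurableSpace Ω] {γ : Measure Ω} [IsFiniteMeasure γ]
    {τ : Ω → Ω} {R : Ω → ℝ} {κ : ℝ} (h : CameronMartinShift γ τ R κ) : Integrable R γ := by
  refine ⟨h.measurable_density.aestronglyMeasurable, ?_⟩
  rw [hasFiniteIntegral_iff_ofReal (ae_of_all _ fun ω => (h.density_pos ω).le),
    ← setLIntegral_univ, ← withDensity_apply _ MeasurableSet.univ, h.withDensity_density]
  exact measure_lt_top _ _

lemma pi {ι : Type*} [Fintype ι] {Ω : ι → Type*} [∀ i, MeasurableSpace (Ω i)]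
    {γ : ∀ i, Measure (Ω i)} [∀ i, IsFiniteMeasure (γ i)] {τ : ∀ i, Ω i → Ω i}
    {R : ∀ i, Ω i → ℝ} {κ : ι → ℝ} (h : ∀ i, CameronMartinShift (γ i) (τ i) (R i) (κ i)) :
    CameronMartinShift (Measure.pi γ) (fun ω i => τ i (ω i)) (fun ω => ∏ i, R i (ω i))
      (∑ i, κ i) where
  measurable_shift := measurable_pi_lambda _ fun i =>
    (h i).measurable_shift.comp (measurable_pi_apply i)
  measurable_density := Finset.measurable_prod _ fun i _ =>
    (h i).measurable_density.comp (measurable_pi_apply i)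
  density_pos ω := Finset.prod_pos fun i _ => (h i).density_pos (ω i)
  withDensity_density := by
    have (i : ι) : IsFiniteMeasure ((γ i).map (τ i)) := Measure.isFiniteMeasure_map _ _
    rw [Measure.pi_map_pi fun i => (h i).measurable_shift.aemeasurable]
    refine (Measure.pi_eq fun s hs => ?_).symm
    rw [withDensity_apply _ (MeasurableSet.univ_pi hs), Measure.restrict_pi_pi,
      ← ofReal_integral_eq_lintegral_ofReal
        (Integrable.fintype_prod_dep fun i => (h i).integrable_density.integrableOn)
        (ae_of_all _ fun ω => Finset.prod_nonneg fun i _ => ((h i).density_pos (ω i)).le),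
      integral_fintype_prod_eq_prod,
      ENNReal.ofReal_prod_of_nonneg fun i _ => integral_nonneg fun x => ((h i).density_pos x).le]
    refine Finset.prod_congr rfl fun i _ => ?_
    rw [← (h i).withDensity_density, withDensity_apply _ (hs i),
      ofReal_integral_eq_lintegral_ofReal (h i).integrable_density.integrableOn
        (ae_of_all _ fun x => ((h i).density_pos x).le)]
  density_shift ω := by
    simp only [(h _).density_shift, Finset.prod_mul_distrib, Real.exp_sum]

end CameronMartinShift

lemma cameronMartinShift_gaussianReal (a Δ : ℝ) {v : ℝ≥0} (hv : v ≠ 0) :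
    CameronMartinShift (gaussianReal a v) (Δ + ·)
      (fun x => Real.exp ((Δ * (x - a) - Δ ^ 2 / 2) / v)) (Δ ^ 2 / v) where
  measurable_shift := measurable_const_add Δ
  measurable_density := by fun_prop
  density_pos x := Real.exp_pos _
  withDensity_density := by
    rw [gaussianReal_map_const_add, gaussianReal_of_var_ne_zero _ hv,
      gaussianReal_of_var_ne_zero _ hv,
      ← withDensity_mul _ (measurable_gaussianPDF _ _) (by fun_prop)]
    congr 1
    ext x
    have hv' : (v : ℝ) ≠ 0 := mod_cast hv
    rw [Pi.mul_apply, gaussianPDF, gaussianPDF, ← ENNReal.ofReal_mul (gaussianPDFReal_nonneg _ _ _),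
      gaussianPDFReal, gaussianPDFReal, mul_assoc, ← Real.exp_add]
    congr 3
    field_simp
    ring
  density_shift x := by
    rw [← Real.exp_add]
    ring_nf

lemma pi_gaussianReal_map_sub_add {ι : Type*} [Fintype ι] (a b : ι → ℝ) (v : ℝ≥0) :
    (Measure.pi fun i => gaussianReal (a i) v).map (fun z i => (b i - a i) + z i) =
      Measure.pi fun i => gaussianReal (b i) v := by
  have (i : ι) : IsFiniteMeasure ((gaussianReal (a i) v).map (b i - a i + ·)) :=
    Measure.isFiniteMeasure_map _ _
  rw [Measure.pi_map_pi fun i => (measurable_const_add (b i - a i)).aemeasurable]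
  simp only [gaussianReal_map_const_add, add_sub_cancel]

lemma dualRenyi_gaussian_mixture {ι : Type*} [Fintype ι] {a b b' : ι → ℝ} {v : ℝ≥0} (hv : v ≠ 0)
    {q r M : ℝ} {k : ℕ} (hb : ∑ i, (b i - a i) ^ 2 / v ≤ M) (hb' : ∑ i, (b' i - a i) ^ 2 / v ≤ M)
    (hq0 : 0 ≤ q) (hq1 : q ≤ 1) (hkr : (k : ℝ).HolderConjugate r) (hk : 4 * k * M ≤ 1) :
    DualRenyi (r * r) (ENNReal.ofReal (Real.exp (4 * k * q ^ 2 * M)))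
      (ENNReal.ofReal (1 - q) • (Measure.pi fun i => gaussianReal (a i) v) +
        ENNReal.ofReal q • Measure.pi fun i => gaussianReal (b i) v)
      (ENNReal.ofReal (1 - q) • (Measure.pi fun i => gaussianReal (a i) v) +
        ENNReal.ofReal q • Measure.pi fun i => gaussianReal (b' i) v) := by
  rw [← pi_gaussianReal_map_sub_add a b, ← pi_gaussianReal_map_sub_add a b']
  have hshift (e : ι → ℝ) := CameronMartinShift.pi fun i =>
    cameronMartinShift_gaussianReal (a i) (e i - a i) hv
  exact (hshift b).dualRenyi_mixture (hshift b') (by positivity) (by positivity) hb hb' hq0 hq1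
    hkr hk

lemma inv_choose_smul_sum_powersetCard_univ {N Y : Type*} [Fintype N] [MeasurableSpace Y]
    {m : ℕ} (hmN : m ≤ Fintype.card N) (ν : Finset N → Measure Y)
    [∀ B, IsProbabilityMeasure (ν B)] :
    (((Fintype.card N).choose m : ℝ≥0∞)⁻¹ •
      ∑ B ∈ Finset.powersetCard m (Finset.univ : Finset N), ν B) Set.univ = 1 := by
  have hchoose : ((Fintype.card N).choose m : ℝ≥0∞) ≠ 0 := mod_cast (Nat.choose_pos hmN).ne'
  simp [ENNReal.inv_mul_cancel hchoose (ENNReal.natCast_ne_top _)]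

section Sampling

variable {N : Type*} [DecidableEq N]

/-- The set obtained from `B` by exchanging the elements `i` and `j`. -/
def swapElem (i j : N) (B : Finset N) : Finset N := B.map (Equiv.swap i j).toEmbedding

lemma card_swapElem (i j : N) (B : Finset N) : (swapElem i j B).card = B.card :=
  Finset.card_map _

lemma mem_swapElem {i j x : N} {B : Finset N} : x ∈ swapElem i j B ↔ Equiv.swap i j x ∈ B := by
  rw [swapElem, Finset.mem_map_equiv, Equiv.symm_swap]

lemma swapElem_swapElem (i j : N) (B : Finset N) : swapElem i j (swapElem i j B) = B := by
  ext x
  rw [mem_swapElem, mem_swapElem, Equiv.swap_apply_self]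

lemma sum_sub_sum_swapElem {A : Type*} [AddCommGroup A] {i j : N} {B : Finset N} (hi : i ∈ B)
    (hj : j ∉ B) (f : N → A) : ∑ x ∈ B, f x - ∑ x ∈ swapElem i j B, f x = f i - f j := by
  rw [swapElem, Finset.sum_map, ← Finset.sum_sub_distrib, Finset.sum_eq_single_of_mem i hi]
  · simp
  · intro x hx hxi
    simp [Equiv.swap_apply_of_ne_of_ne hxi (ne_of_mem_of_not_mem hx hj)]

variable [Fintype N] {A : Type*} [AddCommMonoid A]

/-- Pairs of an `m`-element set containing `i₀` and an element outside of it. -/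
def swapPairs (m : ℕ) (i₀ : N) : Finset (Finset N × N) :=
  {x | x.1.card = m ∧ i₀ ∈ x.1 ∧ x.2 ∉ x.1}

lemma sum_swapPairs_fst (m : ℕ) (i₀ : N) (ψ : Finset N → A) :
    ∑ x ∈ swapPairs m i₀, ψ x.1 =
      (Fintype.card N - m) • ∑ B ∈ Finset.powersetCard m Finset.univ with i₀ ∈ B, ψ B := by
  rw [Finset.sum_finset_product (swapPairs m i₀) {B ∈ Finset.powersetCard m .univ | i₀ ∈ B}
    (fun B => Bᶜ) (by simp [swapPairs, and_assoc]), Finset.smul_sum]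
  refine Finset.sum_congr rfl fun B hB => ?_
  simp only
  rw [Finset.sum_const, Finset.card_compl,
    Finset.mem_powersetCard_univ.1 (Finset.mem_of_mem_filter B hB)]

lemma sum_swapPairs_swapElem (m : ℕ) (i₀ : N) (ψ : Finset N → A) :
    ∑ x ∈ swapPairs m i₀, ψ (swapElem i₀ x.2 x.1) =
      m • ∑ B ∈ Finset.powersetCard m Finset.univ with i₀ ∉ B, ψ B := by
  let swapped : Finset (Finset N × N) := {x | x.1.card = m ∧ i₀ ∉ x.1 ∧ x.2 ∈ x.1}
  have hswap : ∑ x ∈ swapPairs m i₀, ψ (swapElem i₀ x.2 x.1) = ∑ x ∈ swapped, ψ x.1 := by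
    refine Finset.sum_bij' (fun x _ => (swapElem i₀ x.2 x.1, x.2))
      (fun x _ => (swapElem i₀ x.2 x.1, x.2)) ?_ ?_ ?_ ?_ ?_ <;>
    simp +contextual [swapped, swapPairs, card_swapElem, mem_swapElem, swapElem_swapElem]
  rw [hswap, Finset.sum_finset_product swapped {B ∈ Finset.powersetCard m .univ | i₀ ∉ B}
    id (by simp [swapped, and_assoc]), Finset.smul_sum]
  refine Finset.sum_congr rfl fun B hB => ?_
  simp only [id]
  rw [Finset.sum_const, Finset.mem_powersetCard_univ.1 (Finset.mem_of_mem_filter B hB)]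

/-- The common weight of the pairs in `swapPairs m i₀`, for `i₀` in a set with `n` elements: the
inverse of their number. -/
noncomputable def swapWeight (n m : ℕ) : ℝ≥0∞ :=
  ENNReal.ofReal (n / (n.choose m * m * (n - m)))

lemma swapWeight_mul_fst {n m : ℕ} (hm : 1 ≤ m) (hmn : m < n) :
    swapWeight n m * ENNReal.ofReal (m / n) * ((n - m : ℕ) : ℝ≥0∞) = (n.choose m : ℝ≥0∞)⁻¹ := by
  have hchoose : (0 : ℝ) < n.choose m := mod_cast Nat.choose_pos hmn.le
  have hm0 : (0 : ℝ) < m := mod_cast hm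
  have hnm : (0 : ℝ) < n - m := sub_pos.2 (mod_cast hmn)
  have hn0 : (0 : ℝ) < n := by linarith
  rw [swapWeight, ← ENNReal.ofReal_natCast (n - m), ← ENNReal.ofReal_natCast (n.choose m),
    ← ENNReal.ofReal_inv_of_pos hchoose, ← ENNReal.ofReal_mul (by positivity),
    ← ENNReal.ofReal_mul (by positivity), Nat.cast_sub hmn.le]
  congr 1
  field_simp

lemma swapWeight_mul_swapElem {n m : ℕ} (hm : 1 ≤ m) (hmn : m < n) :
    swapWeight n m * ENNReal.ofReal (1 - m / n) * m = (n.choose m : ℝ≥0∞)⁻¹ := by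
  have hchoose : (0 : ℝ) < n.choose m := mod_cast Nat.choose_pos hmn.le
  have hm0 : (0 : ℝ) < m := mod_cast hm
  have hnm : (0 : ℝ) < n - m := sub_pos.2 (mod_cast hmn)
  have hn0 : (0 : ℝ) < n := by linarith
  rw [swapWeight, one_sub_div hn0.ne', ← ENNReal.ofReal_natCast m,
    ← ENNReal.ofReal_natCast (n.choose m), ← ENNReal.ofReal_inv_of_pos hchoose,
    ← ENNReal.ofReal_mul (by positivity), ← ENNReal.ofReal_mul (by positivity)]
  congr 1
  field_simp

lemma inv_choose_smul_sum_powersetCard {Y : Type*} [MeasurableSpace Y] {m : ℕ} (hm : 1 ≤ m)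
    (hmN : m < Fintype.card N) (i₀ : N) (ν : Finset N → Measure Y) :
    ((Fintype.card N).choose m : ℝ≥0∞)⁻¹ • ∑ B ∈ Finset.powersetCard m Finset.univ, ν B =
      ∑ x ∈ swapPairs m i₀, swapWeight (Fintype.card N) m •
        (ENNReal.ofReal (1 - m / Fintype.card N) • ν (swapElem i₀ x.2 x.1) +
          ENNReal.ofReal (m / Fintype.card N) • ν x.1) := by
  rw [← Finset.smul_sum, Finset.sum_add_distrib, ← Finset.smul_sum, ← Finset.smul_sum,
    sum_swapPairs_fst, sum_swapPairs_swapElem, ← Nat.cast_smul_eq_nsmul ℝ≥0∞,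
    ← Nat.cast_smul_eq_nsmul ℝ≥0∞, smul_add, smul_smul, smul_smul, smul_smul, smul_smul,
    swapWeight_mul_fst hm hmN, swapWeight_mul_swapElem hm hmN,
    ← smul_add, add_comm (∑ B ∈ _ with i₀ ∉ B, ν B), Finset.sum_filter_add_sum_filter_not]

lemma sum_swapPairs_swapWeight {m : ℕ} (hm : 1 ≤ m) (hmN : m < Fintype.card N) (i₀ : N) :
    ∑ _x ∈ swapPairs m i₀, swapWeight (Fintype.card N) m = 1 := by
  have hq : (m : ℝ) / Fintype.card N ≤ 1 := div_le_one_of_le₀ (mod_cast hmN.le) (by positivity)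
  have h := inv_choose_smul_sum_powersetCard_univ hmN.le fun _ : Finset N => Measure.dirac ()
  rw [inv_choose_smul_sum_powersetCard hm hmN i₀] at h
  simpa only [Measure.finsetSum_apply, Measure.smul_apply, Measure.add_apply, measure_univ,
    smul_eq_mul, mul_one, ofReal_one_sub_add_ofReal (by positivity) hq] using h

end Sampling

section SubsampledGaussian

variable {N ι : Type*} [Fintype N] [Fintype ι]

/-- The subsampled Gaussian mechanism: the sum of the queries `φ i` over a uniformly random set of
`m` indices `i`, with independent Gaussian noise of variance `v` added to each coordinate. -/
noncomputable def subsampledGaussian (m : ℕ) (v : ℝ≥0) (φ : N → ι → ℝ) : Measure (ι → ℝ) :=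
  ((Fintype.card N).choose m : ℝ≥0∞)⁻¹ • ∑ B ∈ Finset.powersetCard m (Finset.univ : Finset N),
    Measure.pi fun p => gaussianReal (∑ i ∈ B, φ i p) v

lemma isProbabilityMeasure_subsampledGaussian {m : ℕ} (hmN : m ≤ Fintype.card N) (v : ℝ≥0)
    (φ : N → ι → ℝ) : IsProbabilityMeasure (subsampledGaussian m v φ) :=
  ⟨inv_choose_smul_sum_powersetCard_univ hmN _⟩

variable {m k : ℕ} {v : ℝ≥0} {φ φ' : N → ι → ℝ} {i₀ : N} {r M : ℝ}

lemma dualRenyi_subsampledGaussian_of_lt (hm : 1 ≤ m) (hmN : m < Fintype.card N) (hv : v ≠ 0)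
    (hφ : ∀ i ≠ i₀, φ i = φ' i) (hM : ∀ i, ∑ p, (φ i₀ p - φ i p) ^ 2 / v ≤ M)
    (hM' : ∀ i, ∑ p, (φ' i₀ p - φ' i p) ^ 2 / v ≤ M) (hkr : (k : ℝ).HolderConjugate r)
    (hk : 4 * k * M ≤ 1) :
    DualRenyi (r * r) (ENNReal.ofReal (Real.exp (4 * k * (m / Fintype.card N) ^ 2 * M)))
      (subsampledGaussian m v φ) (subsampledGaussian m v φ') := by
  classical
  have hq : (m : ℝ) / Fintype.card N ≤ 1 := div_le_one_of_le₀ (mod_cast hmN.le) (by positivity)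
  rw [subsampledGaussian, subsampledGaussian, inv_choose_smul_sum_powersetCard hm hmN i₀,
    inv_choose_smul_sum_powersetCard hm hmN i₀]
  refine DualRenyi.sum_smul (one_le_mul_of_one_le_of_one_le hkr.symm.lt.le hkr.symm.lt.le)
    (sum_swapPairs_swapWeight hm hmN i₀) fun x hx => ?_
  obtain ⟨-, hi₀, hj⟩ := (Finset.mem_filter.1 hx).2
  have hcommon (p : ι) :
      ∑ i ∈ swapElem i₀ x.2 x.1, φ i p = ∑ i ∈ swapElem i₀ x.2 x.1, φ' i p := by
    refine Finset.sum_congr rfl fun i hi => congrFun (hφ i ?_) p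
    rintro rfl
    exact hj (by simpa [mem_swapElem] using hi)
  have hdiff (ψ : N → ι → ℝ) (p : ι) :
      ∑ i ∈ x.1, ψ i p - ∑ i ∈ swapElem i₀ x.2 x.1, ψ i p = ψ i₀ p - ψ x.2 p :=
    sum_sub_sum_swapElem hi₀ hj fun i => ψ i p
  rw [← funext fun p => congrArg (gaussianReal · v) (hcommon p)]
  refine dualRenyi_gaussian_mixture hv ?_ ?_ (by positivity) hq hkr hk
  · simpa only [hdiff] using hM x.2
  · simpa only [hcommon, hdiff] using hM' x.2

lemma dualRenyi_subsampledGaussian_card (hv : v ≠ 0) (hφ : ∀ i ≠ i₀, φ i = φ' i)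
    (hM : ∑ p, (φ i₀ p - φ' i₀ p) ^ 2 / v ≤ M) (hkr : (k : ℝ).HolderConjugate r)
    (hk : 4 * k * M ≤ 1) :
    DualRenyi (r * r) (ENNReal.ofReal (Real.exp (4 * k * M)))
      (subsampledGaussian (Fintype.card N) v φ) (subsampledGaussian (Fintype.card N) v φ') := by
  have hdiff (p : ι) : ∑ i, φ i p - ∑ i, φ' i p = φ i₀ p - φ' i₀ p := by
    rw [← Finset.sum_sub_distrib, Fintype.sum_eq_single i₀]
    intro i hi
    rw [hφ i hi, sub_self]
  have hM0 : 0 ≤ M := hM.trans' (by positivity)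
  simpa [subsampledGaussian, ← Finset.card_univ] using
    dualRenyi_gaussian_mixture (a := fun p => ∑ i, φ' i p) (b := fun p => ∑ i, φ i p)
      (b' := fun p => ∑ i, φ' i p) hv (by simpa only [hdiff] using hM) (by simpa using hM0)
      zero_le_one le_rfl hkr hk

lemma dualRenyi_subsampledGaussian (hm : 1 ≤ m) (hmN : m ≤ Fintype.card N) (hv : v ≠ 0)
    (hφ : ∀ i ≠ i₀, φ i = φ' i) (hM : ∀ i, ∑ p, (φ i₀ p - φ i p) ^ 2 / v ≤ M)
    (hM' : ∀ i, ∑ p, (φ' i₀ p - φ' i p) ^ 2 / v ≤ M)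
    (hM₀ : ∑ p, (φ i₀ p - φ' i₀ p) ^ 2 / v ≤ M) (hkr : (k : ℝ).HolderConjugate r)
    (hk : 4 * k * M ≤ 1) :
    DualRenyi (r * r) (ENNReal.ofReal (Real.exp (4 * k * (m / Fintype.card N) ^ 2 * M)))
      (subsampledGaussian m v φ) (subsampledGaussian m v φ') := by
  rcases hmN.lt_or_eq with hlt | rfl
  · exact dualRenyi_subsampledGaussian_of_lt hm hlt hv hφ hM hM' hkr hk
  · have hcard : (Fintype.card N : ℝ) ≠ 0 := by positivity
    simpa [hcard] using dualRenyi_subsampledGaussian_card hv hφ hM₀ hkr hk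

end SubsampledGaussian

section Kernels

variable {Y Z W : Type*} [MeasurableSpace Y] [MeasurableSpace Z] [MeasurableSpace W]

lemma measurable_bind_of_measurable_uncurry {κ : Y → Measure Z} (hκ : Measurable κ)
    (hκ' : ∀ y, IsProbabilityMeasure (κ y)) {η : Y → Z → Measure W}
    (hη : Measurable fun x : Y × Z => η x.1 x.2) : Measurable fun y => (κ y).bind (η y) := by
  refine Measure.measurable_of_measurable_coe _ fun t ht => ?_
  let K : Kernel Y Z := ⟨κ, hκ⟩
  have : IsMarkovKernel K := ⟨hκ'⟩
  have hK : Measurable fun y => ∫⁻ z, η y z t ∂K y :=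
    ((Measure.measurable_coe ht).comp hη).lintegral_kernel_prod_right'
  convert hK using 2 with y
  exact Measure.bind_apply ht (hη.comp measurable_prodMk_left).aemeasurable

variable {F : Y → Z → W} {ν : Measure Z} [SFinite ν]

lemma measurable_map_of_measurable_uncurry (hF : Measurable fun x : Y × Z => F x.1 x.2) :
    Measurable fun y => ν.map (F y) := by
  refine Measure.measurable_of_measurable_coe _ fun t ht => ?_
  convert measurable_measure_prodMk_left (ν := ν) (hF ht) using 2 with y
  exact Measure.map_apply (hF.comp measurable_prodMk_left) ht

lemma map_prod_eq_bind_map (μ : Measure Y) (hF : Measurable fun x : Y × Z => F x.1 x.2) :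
    (μ.prod ν).map (fun x => F x.1 x.2) = μ.bind fun y => ν.map (F y) := by
  ext t ht
  rw [Measure.map_apply hF ht, Measure.prod_apply (hF ht),
    Measure.bind_apply ht (measurable_map_of_measurable_uncurry hF).aemeasurable]
  exact lintegral_congr fun y => (Measure.map_apply (hF.comp measurable_prodMk_left) ht).symm

lemma measurable_smul_sum {ι : Type*} (w : ℝ≥0∞) (s : Finset ι) {κ : ι → Y → Measure Z}
    (hκ : ∀ i, Measurable (κ i)) : Measurable fun y => w • ∑ i ∈ s, κ i y := by
  refine Measure.measurable_of_measurable_coe _ fun t ht => ?_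
  simp only [Measure.smul_apply, Measure.finsetSum_apply, smul_eq_mul]
  exact (Finset.measurable_sum _ fun i _ => (Measure.measurable_coe ht).comp (hκ i)).const_mul _

lemma bind_smul_sum {ι : Type*} (μ : Measure Y) (w : ℝ≥0∞) (s : Finset ι)
    {κ : ι → Y → Measure Z} (hκ : ∀ i, Measurable (κ i)) :
    (μ.bind fun y => w • ∑ i ∈ s, κ i y) = w • ∑ i ∈ s, μ.bind (κ i) := by
  ext t ht
  have hκt (i : ι) : Measurable fun y => κ i y t := (Measure.measurable_coe ht).comp (hκ i)
  rw [Measure.bind_apply ht (measurable_smul_sum w s hκ).aemeasurable]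
  simp only [Measure.smul_apply, Measure.finsetSum_apply, smul_eq_mul,
    Measure.bind_apply ht (hκ _).aemeasurable]
  rw [lintegral_const_mul _ (by fun_prop), lintegral_finsetSum _ fun i _ => hκt i]

end Kernels

lemma map_subsampledGaussian {N ι W : Type*} [Fintype N] [Fintype ι] [MeasurableSpace W] (m : ℕ)
    (v : ℝ≥0) (φ : N → ι → ℝ) {F : (ι → ℝ) → W} (hF : Measurable F) :
    (subsampledGaussian m v φ).map F = ((Fintype.card N).choose m : ℝ≥0∞)⁻¹ •
      ∑ B ∈ Finset.powersetCard m (Finset.univ : Finset N),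
        (Measure.pi fun _ => gaussianReal 0 v).map fun z => F fun p => ∑ i ∈ B, φ i p + z p := by
  rw [subsampledGaussian, Measure.map_smul, ← Measure.mapₗ_apply_of_measurable hF, map_sum]
  congr 1
  refine Finset.sum_congr rfl fun B _ => ?_
  have hshift := pi_gaussianReal_map_sub_add 0 (fun p => ∑ i ∈ B, φ i p) v
  simp only [Pi.zero_apply, sub_zero] at hshift
  rw [Measure.mapₗ_apply_of_measurable hF, ← hshift, Measure.map_map hF (by fun_prop)]
  rfl

lemma abs_clip_le {C : ℝ} (hC : 0 < C) (g : ℝ) : |clip C g| ≤ C := by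
  have hmax : 0 < max 1 (|g| / C) := lt_max_of_lt_left one_pos
  rw [clip, abs_div, abs_of_pos hmax, div_le_iff₀ hmax, ← div_le_iff₀' hC]
  exact le_max_right _ _

lemma measurable_clip (C : ℝ) : Measurable (clip C) :=
  measurable_id.div (measurable_const.max (measurable_id.abs.div_const C))

/-- Here `b` is the reciprocal of the Rényi order, and `(1 - b)²` that of the exponent in the dual
bound. -/
lemma composition_condition {a b L ε ℓ : ℝ} (ha : 0 ≤ a) (hb0 : 0 ≤ b) (hb : b ≤ 4⁻¹) (hL : 0 ≤ L)
    (hℓ : -ℓ ≤ L) (hle : a + 2 * L * b ≤ ε / 2) :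
    a - (1 - b) ^ 2 * ε ≤ (1 - (1 - b) ^ 2) * ℓ := by
  have hε : 0 ≤ ε := by
    have : 0 ≤ 2 * L * b := by positivity
    linarith
  have hhalf : 1 / 2 ≤ (1 - b) ^ 2 := by nlinarith
  calc a - (1 - b) ^ 2 * ε ≤ ε / 2 - 2 * L * b - 1 / 2 * ε := by gcongr; linarith
    _ = -(2 * b * L) := by ring
    _ ≤ -((1 - (1 - b) ^ 2) * L) := by gcongr; nlinarith
    _ = (1 - (1 - b) ^ 2) * -L := by ring
    _ ≤ (1 - (1 - b) ^ 2) * ℓ := by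
        gcongr
        · nlinarith
        · linarith

section Algorithm

variable {X : Type*} {d n : ℕ} (c : Config) (f : Param d → X → ℝ) (D : Fin n → X)

/-- The variance `σ²C²` of the scalar noises. -/
noncomputable def noiseVar : ℝ≥0 := Real.toNNReal (c.σ ^ 2 * c.C ^ 2)

/-- The contribution of record `i` to the noisy sum in direction `v p`. -/
noncomputable def recordTerm (s : ℕ) (θ₀ θ : Param d) (v : Fin c.P → Param d) (i : Fin n)
    (p : Fin c.P) : ℝ :=
  clip c.C (finiteDiff f (c.β s) θ (v p) (D i)) + 1 / c.lam * ‖θ - θ₀‖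

/-- The next iterate as a function of the noisy sums `u p`, the only quantities through which an
iteration accesses the data. -/
noncomputable def applySums (s : ℕ) (θ : Param d) (v : Fin c.P → Param d) (u : Fin c.P → ℝ) :
    Param d :=
  θ - c.η s • ((1 / (c.P : ℝ)) • ∑ p, (1 / (c.m : ℝ) * u p) • v p)

/-- The law of one iteration given the random directions `v`. -/
noncomputable def stepLawGiven (s : ℕ) (θ₀ θ : Param d) (v : Fin c.P → Param d) :
    Measure (Param d) :=
  (subsampledGaussian c.m (noiseVar c) (recordTerm c f D s θ₀ θ v)).map (applySums c s θ v)

variable {c f}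

lemma measurable_applySums (s : ℕ) (θ : Param d) (v : Fin c.P → Param d) :
    Measurable (applySums c s θ v) := by
  unfold applySums
  fun_prop

lemma stepLawGiven_eq (s : ℕ) (θ₀ θ : Param d) (v : Fin c.P → Param d) :
    stepLawGiven c f D s θ₀ θ v = (n.choose c.m : ℝ≥0∞)⁻¹ •
      ∑ B ∈ Finset.powersetCard c.m (Finset.univ : Finset (Fin n)),
        (Measure.pi fun _ : Fin c.P => gaussianReal 0 (noiseVar c)).map
          (update c f D s θ₀ θ B v) := by
  rw [stepLawGiven, map_subsampledGaussian _ _ _ (measurable_applySums s θ v), Fintype.card_fin]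
  rfl

lemma measurable_update (hf : ∀ x, Measurable fun θ => f θ x) (s : ℕ) (B : Finset (Fin n)) :
    Measurable fun x : (Param d × Param d) × ((Fin c.P → Param d) × (Fin c.P → ℝ)) =>
      update c f D s x.1.1 x.1.2 B x.2.1 x.2.2 := by
  have hclip (p : Fin c.P) (i : Fin n) : Measurable
      fun x : (Param d × Param d) × ((Fin c.P → Param d) × (Fin c.P → ℝ)) =>
        clip c.C (finiteDiff f (c.β s) x.1.2 (x.2.1 p) (D i)) := by
    refine (measurable_clip _).comp (Measurable.const_mul (Measurable.sub ?_ ?_) _)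
    · exact (hf (D i)).comp (by fun_prop)
    · exact (hf (D i)).comp (by fun_prop)
  unfold update
  fun_prop

lemma measurable_update_right (hf : ∀ x, Measurable fun θ => f θ x) (s : ℕ) (θ₀ θ : Param d)
    (B : Finset (Fin n)) :
    Measurable fun w : (Fin c.P → Param d) × (Fin c.P → ℝ) => update c f D s θ₀ θ B w.1 w.2 :=
  (measurable_update D hf s B).comp (measurable_prodMk_left (x := (θ₀, θ)))

lemma measurable_stepLawGiven (hf : ∀ x, Measurable fun θ => f θ x) (s : ℕ) (θ₀ θ : Param d) :
    Measurable (stepLawGiven c f D s θ₀ θ) := by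
  rw [funext (stepLawGiven_eq D s θ₀ θ)]
  exact measurable_smul_sum _ _ fun B =>
    measurable_map_of_measurable_uncurry (measurable_update_right D hf s θ₀ θ B)

lemma stepLaw_eq_bind (hf : ∀ x, Measurable fun θ => f θ x) (s : ℕ) (θ₀ θ : Param d) :
    stepLaw c f D s θ₀ θ =
      (Measure.pi fun _ : Fin c.P => stdGaussian (Param d)).bind (stepLawGiven c f D s θ₀ θ) := by
  have hu := measurable_update_right (c := c) D hf s θ₀ θ
  simp only [funext (stepLawGiven_eq D s θ₀ θ)]
  rw [bind_smul_sum _ _ _ fun B => measurable_map_of_measurable_uncurry (hu B)]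
  simp only [← map_prod_eq_bind_map _ (hu _)]
  rfl

lemma measurable_stepLaw (hf : ∀ x, Measurable fun θ => f θ x) (s : ℕ) :
    Measurable fun x : Param d × Param d => stepLaw c f D s x.1 x.2 := by
  unfold stepLaw
  refine measurable_smul_sum _ _ fun B => ?_
  exact measurable_map_of_measurable_uncurry
    (F := fun (x : Param d × Param d) (w : (Fin c.P → Param d) × (Fin c.P → ℝ)) =>
      update c f D s x.1 x.2 B w.1 w.2) (measurable_update D hf s B)

lemma isProbabilityMeasure_stepLaw (hf : ∀ x, Measurable fun θ => f θ x) (hmn : c.m ≤ n) (s : ℕ)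
    (θ₀ θ : Param d) : IsProbabilityMeasure (stepLaw c f D s θ₀ θ) := by
  rw [stepLaw_eq_bind D hf]
  have (v : Fin c.P → Param d) : IsProbabilityMeasure
      (subsampledGaussian c.m (noiseVar c) (recordTerm c f D s θ₀ θ v)) :=
    isProbabilityMeasure_subsampledGaussian (by simpa using hmn) _ _
  exact isProbabilityMeasure_bind (measurable_stepLawGiven D hf s θ₀ θ).aemeasurable <|
    ae_of_all _ fun v =>
      Measure.isProbabilityMeasure_map (measurable_applySums s θ v).aemeasurable

lemma measurable_and_isProbabilityMeasure_innerLaw (hf : ∀ x, Measurable fun θ => f θ x)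
    (hmn : c.m ≤ n) (s t : ℕ) :
    Measurable (fun θ₀ => innerLaw c f D s θ₀ t) ∧
      ∀ θ₀, IsProbabilityMeasure (innerLaw c f D s θ₀ t) := by
  induction t with
  | zero => exact ⟨Measure.measurable_dirac, fun θ₀ => Measure.dirac.isProbabilityMeasure⟩
  | succ t ih =>
    obtain ⟨hmeas, _⟩ := ih
    have hstep := measurable_stepLaw (c := c) D hf s
    exact ⟨measurable_bind_of_measurable_uncurry hmeas inferInstance hstep, fun θ₀ =>
      isProbabilityMeasure_bind (hstep.comp measurable_prodMk_left).aemeasurable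
        (ae_of_all _ fun θ => isProbabilityMeasure_stepLaw D hf hmn s θ₀ θ)⟩

lemma measurable_innerLaw (hf : ∀ x, Measurable fun θ => f θ x) (hmn : c.m ≤ n) (s t : ℕ) :
    Measurable fun θ₀ => innerLaw c f D s θ₀ t :=
  (measurable_and_isProbabilityMeasure_innerLaw D hf hmn s t).1

lemma isProbabilityMeasure_innerLaw (hf : ∀ x, Measurable fun θ => f θ x) (hmn : c.m ≤ n)
    (s t : ℕ) (θ₀ : Param d) : IsProbabilityMeasure (innerLaw c f D s θ₀ t) :=
  (measurable_and_isProbabilityMeasure_innerLaw D hf hmn s t).2 θ₀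

lemma isProbabilityMeasure_stageLaw (hf : ∀ x, Measurable fun θ => f θ x) (hmn : c.m ≤ n)
    (θinit : Param d) (s : ℕ) : IsProbabilityMeasure (stageLaw c f D θinit s) := by
  induction s with
  | zero => exact Measure.dirac.isProbabilityMeasure
  | succ s ih =>
    exact isProbabilityMeasure_bind (measurable_innerLaw D hf hmn _ _).aemeasurable
      (ae_of_all _ fun θ => isProbabilityMeasure_innerLaw D hf hmn _ _ θ)

variable {D} {D' : Fin n → X}

lemma recordTerm_sub_sq_sum_le (hC : 0 < c.C) (hσ : c.σ ≠ 0) (s : ℕ) (θ₀ θ : Param d)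
    (v : Fin c.P → Param d) (i j : Fin n) :
    ∑ p, (recordTerm c f D s θ₀ θ v i p - recordTerm c f D' s θ₀ θ v j p) ^ 2 / (noiseVar c : ℝ) ≤
      4 * c.P / c.σ ^ 2 := by
  have hdiff (p : Fin c.P) :
      |recordTerm c f D s θ₀ θ v i p - recordTerm c f D' s θ₀ θ v j p| ≤ 2 * c.C := by
    rw [recordTerm, recordTerm, add_sub_add_right_eq_sub]
    calc _ ≤ _ := abs_sub _ _
      _ ≤ c.C + c.C := add_le_add (abs_clip_le hC _) (abs_clip_le hC _)
      _ = 2 * c.C := (two_mul _).symm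
  calc ∑ p, (recordTerm c f D s θ₀ θ v i p - recordTerm c f D' s θ₀ θ v j p) ^ 2 / (noiseVar c : ℝ)
      ≤ ∑ _p : Fin c.P, (2 * c.C) ^ 2 / (c.σ ^ 2 * c.C ^ 2) := by
        rw [noiseVar, Real.coe_toNNReal _ (by positivity)]
        refine Finset.sum_le_sum fun p _ => div_le_div_of_nonneg_right ?_ (by positivity)
        exact sq_le_sq' (abs_le.1 (hdiff p)).1 (abs_le.1 (hdiff p)).2
    _ = 4 * c.P / c.σ ^ 2 := by
        rw [Finset.sum_const, Finset.card_univ, Fintype.card_fin, nsmul_eq_mul]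
        field_simp
        ring

lemma dualRenyi_stepLaw (hf : ∀ x, Measurable fun θ => f θ x) (hC : 0 < c.C) (hσ : c.σ ≠ 0)
    (hm : 1 ≤ c.m) (hmn : c.m ≤ n) {k : ℕ} {r : ℝ} (hkr : (k : ℝ).HolderConjugate r)
    (hk : 4 * k * (4 * c.P / c.σ ^ 2) ≤ 1) (hD : Adjacent D D') (s : ℕ) (θ₀ θ : Param d) :
    DualRenyi (r * r)
      (ENNReal.ofReal (Real.exp (4 * k * ((c.m : ℝ) / n) ^ 2 * (4 * c.P / c.σ ^ 2))))
      (stepLaw c f D s θ₀ θ) (stepLaw c f D' s θ₀ θ) := by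
  obtain ⟨i₀, hi₀⟩ := hD
  have hrr : 1 < r * r := one_lt_mul_of_lt_of_le hkr.symm.lt hkr.symm.lt.le
  have hvar : noiseVar c ≠ 0 := (Real.toNNReal_pos.2 (by positivity)).ne'
  have hgiven (v : Fin c.P → Param d) := dualRenyi_subsampledGaussian hm (by simpa using hmn) hvar
    (fun i hi => funext fun p => by rw [recordTerm, recordTerm, hi₀ i hi])
    (fun i => recordTerm_sub_sq_sum_le (D := D) (D' := D) (f := f) hC hσ s θ₀ θ v i₀ i)
    (fun i => recordTerm_sub_sq_sum_le (D := D') (D' := D') hC hσ s θ₀ θ v i₀ i)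
    (recordTerm_sub_sq_sum_le hC hσ s θ₀ θ v i₀ i₀) hkr hk
  have hbind := (DualRenyi.refl hrr (Measure.pi fun _ : Fin c.P => stdGaussian (Param d))).bind
    (one_pos.trans hrr) (measurable_stepLawGiven D hf s θ₀ θ) (measurable_stepLawGiven D' hf s θ₀ θ)
    fun v => (hgiven v).map (measurable_applySums s θ v)
  rwa [← stepLaw_eq_bind D hf, ← stepLaw_eq_bind D' hf, one_mul, Fintype.card_fin] at hbind

lemma dualRenyi_innerLaw (hf : ∀ x, Measurable fun θ => f θ x) {r a : ℝ} (hr : 1 < r) {s : ℕ}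
    {θ₀ : Param d} (hstep : ∀ θ, DualRenyi r (ENNReal.ofReal (Real.exp a))
      (stepLaw c f D s θ₀ θ) (stepLaw c f D' s θ₀ θ)) (t : ℕ) :
    DualRenyi r (ENNReal.ofReal (Real.exp (t * a)))
      (innerLaw c f D s θ₀ t) (innerLaw c f D' s θ₀ t) := by
  induction t with
  | zero => simpa [innerLaw] using DualRenyi.refl hr (Measure.dirac θ₀)
  | succ t ih =>
    have h := ih.bind (one_pos.trans hr)
      ((measurable_stepLaw D hf s).comp measurable_prodMk_left)
      ((measurable_stepLaw D' hf s).comp measurable_prodMk_left) hstep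
    rwa [← ENNReal.ofReal_mul (Real.exp_pos _).le, ← Real.exp_add, ← add_one_mul,
      ← Nat.cast_add_one] at h

lemma dualRenyi_stageLaw (hf : ∀ x, Measurable fun θ => f θ x) (hmn : c.m ≤ n) {r a : ℝ}
    (hr : 1 < r) (hstep : ∀ s θ₀ θ, DualRenyi r (ENNReal.ofReal (Real.exp a))
      (stepLaw c f D s θ₀ θ) (stepLaw c f D' s θ₀ θ)) (θinit : Param d) (s : ℕ) :
    DualRenyi r (ENNReal.ofReal (Real.exp ((∑ i ∈ Finset.Icc 1 s, c.T i : ℕ) * a)))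
      (stageLaw c f D θinit s) (stageLaw c f D' θinit s) := by
  induction s with
  | zero => simpa [stageLaw] using DualRenyi.refl hr (Measure.dirac θinit)
  | succ s ih =>
    have h := ih.bind (one_pos.trans hr) (measurable_innerLaw D hf hmn (s + 1) (c.T (s + 1)))
      (measurable_innerLaw D' hf hmn (s + 1) (c.T (s + 1)))
      fun θ => dualRenyi_innerLaw hf hr (hstep (s + 1) θ) (c.T (s + 1))
    rwa [← ENNReal.ofReal_mul (Real.exp_pos _).le, ← Real.exp_add, ← add_mul, ← Nat.cast_add,
      ← Finset.sum_Icc_succ_top (by omega)] at h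

theorem isDP_of_order (hf : ∀ x, Measurable fun θ => f θ x) (hC : 0 < c.C) (hσ : c.σ ≠ 0)
    (hm : 1 ≤ c.m) (hmn : c.m ≤ n) {k : ℕ} {L ε δ : ℝ} (hk : 4 ≤ k)
    (hkM : 4 * k * (4 * c.P / c.σ ^ 2) ≤ 1) (hδ : 0 < δ) (hL : 0 ≤ L) (hLδ : -Real.log δ ≤ L)
    (hle : c.totalSteps * (4 * k * ((c.m : ℝ) / n) ^ 2 * (4 * c.P / c.σ ^ 2)) + 2 * L / k ≤ ε / 2)
    (θinit : Param d) :
    IsDP (fun D : Fin n → X => stagewiseDPZO c f D θinit) ε δ := by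
  intro D D' hD t ht
  have hk1 : (1 : ℝ) < k := mod_cast (by omega : 1 < k)
  have hkr := Real.HolderConjugate.conjExponent hk1
  set r := (k : ℝ).conjExponent
  have hrr : 1 < r * r := one_lt_mul_of_lt_of_le hkr.symm.lt hkr.symm.lt.le
  have hdual := dualRenyi_stageLaw hf hmn hrr
    (dualRenyi_stepLaw (f := f) hf hC hσ hm hmn hkr hkM hD) θinit c.S
  have := isProbabilityMeasure_stageLaw (c := c) D' hf hmn θinit c.S
  refine hdual.measure_le hrr hδ ?_ ht
  have hr : 1 / (r * r) = (1 - (k : ℝ)⁻¹) ^ 2 := by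
    rw [hkr.one_sub_inv, one_div, mul_inv, sq]
  have hk4 : (k : ℝ)⁻¹ ≤ 4⁻¹ := inv_anti₀ (by norm_num) (mod_cast hk)
  rw [hr]
  exact composition_condition (by positivity) (by positivity) hk4 hL hLδ hle

end Algorithm

/-- The order is `k ≈ 8 L / ε`, for which `2 L / k` is at most `ε / 4`. -/
lemma exists_order {K c₁ L ε M W : ℝ} (hK : 0 < K) (hc₁ : 0 < c₁) (hε : 0 < ε) (hM : 0 ≤ M)
    (hεL : ε ≤ K * L) (hεW : ε < c₁ * W)
    (hMW : M * (64 * (8 + 5 * K) * (1 + c₁) * (W * L)) ≤ 4 * ε ^ 2) :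
    ∃ k : ℕ, 4 ≤ k ∧ 4 * k * M ≤ 1 ∧ 4 * k * W * M + 2 * L / k ≤ ε / 2 := by
  have hL : 0 < L := pos_of_mul_pos_right (hε.trans_le hεL) hK.le
  have hW : 0 < W := pos_of_mul_pos_right (hε.trans hεW) hc₁.le
  have hdiv : 0 < 8 * L / ε := by positivity
  obtain ⟨k, hk, hk'⟩ : ∃ k : ℕ, 8 * L / ε + 4 ≤ k ∧ k < 8 * L / ε + 4 + 1 :=
    ⟨_, Nat.le_ceil _, Nat.ceil_lt_add_one (by positivity)⟩
  have hk0 : (0 : ℝ) < k := by linarith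
  have hkL : 8 * L ≤ k * ε := (div_le_iff₀ hε).1 (by linarith)
  have hkε : k * ε ≤ (8 + 5 * K) * L := by
    have : (8 * L / ε) * ε = 8 * L := div_mul_cancel₀ _ hε.ne'
    nlinarith
  have hkMW : k * M * W * (16 * (1 + c₁)) ≤ ε := by
    have hpos : 0 < 4 * (8 + 5 * K) * ε := by positivity
    refine le_of_mul_le_mul_right ?_ hpos
    calc k * M * W * (16 * (1 + c₁)) * (4 * (8 + 5 * K) * ε)
        = M * W * (64 * (8 + 5 * K) * (1 + c₁)) * (k * ε) := by ring
      _ ≤ M * W * (64 * (8 + 5 * K) * (1 + c₁)) * ((8 + 5 * K) * L) := by gcongr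
      _ = (8 + 5 * K) * (M * (64 * (8 + 5 * K) * (1 + c₁) * (W * L))) := by ring
      _ ≤ (8 + 5 * K) * (4 * ε ^ 2) := by gcongr
      _ = ε * (4 * (8 + 5 * K) * ε) := by ring
  have hkMW0 : 0 ≤ k * M * W := by positivity
  refine ⟨k, ?_, ?_, ?_⟩
  · exact_mod_cast (by linarith : (4 : ℝ) ≤ k)
  · refine le_of_mul_le_mul_right ?_ hε
    calc 4 * k * M * ε ≤ 4 * k * M * (c₁ * W) := by gcongr
      _ ≤ k * M * W * (16 * (1 + c₁)) := by nlinarith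
      _ ≤ 1 * ε := by rwa [one_mul]
  · have hLk : 2 * L / k ≤ ε / 4 := by
      rw [div_le_iff₀ hk0]
      linarith
    nlinarith

end DPZO

theorem mainTheorem1_general {K c₁ : ℝ} (hK : 0 < K) (hc₁ : 0 < c₁) :
    ∃ c₂ > (0 : ℝ),
      ∀ (X : Type*) (d n : ℕ) (c : DPZO.Config) (f : DPZO.Param d → X → ℝ)
        (θinit : DPZO.Param d) (ε δ L : ℝ),
        (∀ x, Measurable fun θ => f θ x) →
        1 ≤ c.P → 1 ≤ c.m → c.m ≤ n → 0 < c.C → 0 < ε → 0 < δ →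
        -Real.log δ ≤ L → ε ≤ K * L →
        ε < c₁ * (c.m : ℝ) ^ 2 * c.totalSteps / (n : ℝ) ^ 2 →
        c₂ ^ 2 * c.P * (c.m : ℝ) ^ 2 * c.totalSteps * L / (ε ^ 2 * (n : ℝ) ^ 2) ≤ c.σ ^ 2 →
        DPZO.IsDP (fun D : Fin n → X => DPZO.stagewiseDPZO c f D θinit) ε δ := by
  refine ⟨√(64 * (8 + 5 * K) * (1 + c₁)), by positivity, ?_⟩
  intro X d n c f θinit ε δ L hf hP hm hmn hC hε hδ hLδ hεL hεT hσ
  have hL : 0 < L := pos_of_mul_pos_right (hε.trans_le hεL) hK.le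
  have hP0 : (0 : ℝ) < c.P := mod_cast hP
  have hn0 : (0 : ℝ) < n := mod_cast hm.trans hmn
  set W : ℝ := c.totalSteps * ((c.m : ℝ) / n) ^ 2 with hW
  have hεW : ε < c₁ * W := hεT.trans_eq (by rw [hW]; field_simp)
  have hW0 : 0 < W := pos_of_mul_pos_right (hε.trans hεW) hc₁.le
  rw [Real.sq_sqrt (by positivity)] at hσ
  have hσW : 64 * (8 + 5 * K) * (1 + c₁) * c.P * (W * L) / ε ^ 2 ≤ c.σ ^ 2 :=
    hσ.trans_eq' (by rw [hW]; field_simp)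
  have hσ0 : 0 < c.σ ^ 2 := hσW.trans_lt' (by positivity)
  have hMW : 4 * c.P / c.σ ^ 2 * (64 * (8 + 5 * K) * (1 + c₁) * (W * L)) ≤ 4 * ε ^ 2 := by
    rw [div_le_iff₀ (by positivity)] at hσW
    rw [div_mul_eq_mul_div, div_le_iff₀ hσ0]
    linarith
  obtain ⟨k, hk, hkM, hle⟩ := DPZO.exists_order hK hc₁ hε (by positivity) hεL hεW hMW
  refine DPZO.isDP_of_order hf hC (sq_pos_iff.1 hσ0) hm hmn hk hkM hδ hL.le hLδ ?_ θinit
  exact hle.trans_eq' (by rw [hW]; ring)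

theorem mainTheorem1 (K : ℝ) (hK : 0 < K) :
    ∃ c₁ > (0 : ℝ), ∃ c₂ > (0 : ℝ),
      ∀ (X : Type*) (d n : ℕ) (c : DPZO.Config) (f : DPZO.Param d → X → ℝ)
        (θinit : DPZO.Param d) (ε δ : ℝ),
        (∀ x, Measurable fun θ => f θ x) →
        1 ≤ c.P → 1 ≤ c.m → c.m ≤ n →
        0 < c.C → 0 < c.lam → 0 ≤ c.η₀ → 0 < c.β₀ → 0 < c.k →
        0 < ε → 0 < δ →
        ε ≤ K * Real.log (c.P / δ) →
        ε < c₁ * (c.m : ℝ) ^ 2 * c.totalSteps / (n : ℝ) ^ 2 →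
        c₂ ^ 2 * (c.P : ℝ) ^ 2 * (c.m : ℝ) ^ 2 * c.totalSteps * Real.log (c.P / δ)
            / (ε ^ 2 * (n : ℝ) ^ 2) ≤ c.σ ^ 2 →
        DPZO.IsDP (fun D : Fin n → X => DPZO.stagewiseDPZO c f D θinit) ε δ := by
  obtain ⟨c₂, hc₂, hDP⟩ := mainTheorem1_general hK one_pos
  refine ⟨1, one_pos, c₂, hc₂, ?_⟩
  intro X d n c f θinit ε δ hf hP hm hmn hC _ _ _ _ hε hδ hεL hεT hσ
  have hP1 : (1 : ℝ) ≤ c.P := mod_cast hP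
  have hL : 0 < Real.log (c.P / δ) := pos_of_mul_pos_right (hε.trans_le hεL) hK.le
  have hLδ : -Real.log δ ≤ Real.log (c.P / δ) := by
    rw [Real.log_div (by positivity) hδ.ne']
    linarith [Real.log_nonneg hP1]
  refine hDP X d n c f θinit ε δ _ hf hP hm hmn hC hε hδ hLδ hεL hεT (hσ.trans' ?_)
  gcongr
  exact le_self_pow₀ hP1 two_ne_zero
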